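/- Let $n\ge 2$ be an integer. Let $\mathcal L$ be the set of elements $a_{i_1,\dots,i_k}$ with $1\le k\le n-1$ and $1\le i_1<\dots<i_k\le n$, ordered by $a_{i_1,\dots,i_k}\le a_{i'_1,\dots,i'_l}$ iff $k\ge l$ and $i_j\le i'_j$ for all $j\le l$; this is a distributive lattice. Let $R=\mathbb C[X_a : a\in\mathcal L]$, regarded as the multihomogeneous coordinate ring of $\mathbb P_{\mathrm{mult}}=\mathbb P(\wedge^1\mathbb C^n)\times\dots\times\mathbb P(\wedge^{n-1}\mathbb C^n)$, where $X_{a_{i_1,\dots,i_k}}$ is the coordinate on $\wedge^k\mathbb C^n$ corresponding to $e_{i_1}\wedge\dots\wedge e_{i_k}$. The subvariety cut out by a multihomogeneous ideal is its zero set in $\mathbb P_{\mathrm{mult}}$. Let $I^h\subset R$ be the Hibi ideal, generated by $X_aX_b-X_{a\vee b}X_{a\wedge b}$ for all $a,b\in\mathcal L$, and let $H_{\mathrm{mult}}\subset\mathbb P_{\mathrm{mult}}$ be the subvariety cut out by $I^h$. Let $\overline P=\{p_{r,s} : 1\le r\le s\le n\}$ and $P=\overline P\setminus\{p_{1,1},p_{n,n}\}$,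 and let $<$ be the order on $P$ with $p_{r,s}\le p_{u,v}$ iff $r\le u$ and $s\le v$. For $a=a_{i_1,\dots,i_k}$ let $\iota(a)\subset P$ consist of the $p_{r,\,n-j+1}\in P$ with $1\le j\le k$ and $1\le r\le i_j-j$, and of all $p_{r,s}\in P$ with $s<n-k+1$; the map $\iota$ is an isomorphism from $\mathcal L$ to the lattice of order ideals (lower sets) of $(P,<)$. Let $<'$ be a (strict partial) order on $P$ that is stronger than $<$, i.e. $p<q$ implies $p<'q$. Let $\mathcal M_{<'}\subset\mathcal L$ be the sublattice of those $a$ for which $\iota(a)$ is an order ideal of $(P,<')$, and let $I_{<'}\subset R$ be the ideal generated by all $X_aX_b-X_{a\vee b}X_{a\wedge b}$ with $a,b\in\mathcal M_{<'}$ and all $X_a$ with $a\notin\mathcal M_{<'}$. Extend $<'$ to $\overline P$ by making $p_{1,1}$ the unique minimal and $p_{n,n}$ the unique maximal element, let $M=\{p_{r,r} : 1\le r\le n\}$ and $\mu_{p_{r,r}}=\frac{n-r}{n-1}$, and let $$O_{M,\mu}(\overline P,<')=\{x\in\mathbb R^{\overline P} : x_p=\mu_p\text{ for }p\in M,\ x_p\ge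 x_q\text{ whenever }p<'q\}$$ be the corresponding marked order polytope; $O_{M,\mu}(\overline P,<)$ is a Gelfand–Tsetlin polytope. For a rational polytope $Q\subset\mathbb R^{\overline P}$, the toric variety $Z_Q$ associated with $Q$ is, up to isomorphism, the Zariski closure in $\mathbb P(\mathbb C^{A})$, $A=kQ\cap\mathbb Z^{\overline P}$, of the set of points $\big[\prod_{p}t_p^{m_p}\big]_{m\in A}$, $t\in(\mathbb C^*)^{\overline P}$. Here $k>0$ is any integer such that $kQ$ is a normal lattice polytope, i.e. the convex hull of a nonempty finite set of integer points such that for all $l>0$ every integer point of $lkQ$ is a sum of $l$ integer points of $kQ$. **Lemma.** For every order $<'$ on $P$ stronger than $<$, the subvariety of $\mathbb P_{\mathrm{mult}}$ cut out by $I_{<'}$ is isomorphic to the toric variety $Z_{O_{M,\mu}(\overline P,<')}$: there is an integer $k>0$ such that $k\,O_{M,\mu}(\overline P,<')$ is a normal lattice polytope, and for every such $k$ the subvariety is isomorphic to the projective toric variety described above. In particular (the case where $<'$ is $<$), $H_{\mathrm{mult}}$ is isomorphic to the toric variety of the Gelfand–Tsetlin polytope $O_{M,\mu}(\overline P,<)$.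 -/

import Mathlib

open scoped Pointwise LinearAlgebra.Projectivization

noncomputable section

/-! ### Algebraic subsets of products of projective spaces over `ℂ` -/

/-- The product `∏ₖ ℙ(ℂ^{ι k})` of projective spaces. Its multihomogeneous coordinate ring is
`MvPolynomial (Σ k, ι k) ℂ`; the variable `⟨k, i⟩` is the `i`-th coordinate on the `k`-th factor. -/
def MultiProj {κ : Type} (ι : κ → Type) : Type := ∀ k, ℙ ℂ (ι k → ℂ)

namespace MultiProj

variable {κ : Type} {ι : κ → Type}

open Classical in
/-- `F` is multihomogeneous of multidegree `d`: for every `k` it is homogeneous of degree `d k`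
in the variables of the `k`-th group. -/
def IsMultiHom (F : MvPolynomial (Σ k, ι k) ℂ) (d : κ → ℕ) : Prop :=
  MvPolynomial.IsWeightedHomogeneous (fun s : Σ k, ι k => (Pi.single s.1 1 : κ → ℕ)) F d

/-- The value of `F` at a choice of homogeneous coordinates of the point `x`. It is only used to
say that a multihomogeneous `F` does (not) vanish at `x`, and in quotients of two multihomogeneous
polynomials of equal multidegree; neither depends on the choice. -/
def evalAt (x : MultiProj ι) (F : MvPolynomial (Σ k, ι k) ℂ) : ℂ :=
  MvPolynomial.eval (fun s : Σ k, ι k => (x s.1).rep s.2) F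

/-- The common zero set of all multihomogeneous elements of `S`. -/
def zeroLocus (S : Set (MvPolynomial (Σ k, ι k) ℂ)) : Set (MultiProj ι) :=
  {x | ∀ F ∈ S, ∀ d, IsMultiHom F d → evalAt x F = 0}

/-- The Zariski topology: the closed sets are the zero sets of sets of multihomogeneous
polynomials. -/
instance zariskiTopology : TopologicalSpace (MultiProj ι) :=
  TopologicalSpace.ofClosed (Set.range (zeroLocus (ι := ι)))
    (by
      refine ⟨{1}, ?_⟩
      ext x
      simp only [zeroLocus, Set.mem_ofPred_eq, Set.mem_singleton_iff, forall_eq,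
        Set.mem_empty_iff_false, iff_false, not_forall]
      refine ⟨0, MvPolynomial.isWeightedHomogeneous_one ℂ _, ?_⟩
      simp [evalAt])
    (by
      intro A hA
      refine ⟨⋃₀ {S | zeroLocus S ∈ A}, ?_⟩
      ext x
      constructor
      · intro hx Z hZ
        obtain ⟨S, rfl⟩ := hA hZ
        exact fun F hF d hd => hx F ⟨S, hZ, hF⟩ d hd
      · rintro hx F ⟨S, hS, hF⟩ d hd
        exact hx _ hS F hF d hd)
    (by
      rintro _ ⟨S, rfl⟩ _ ⟨T, rfl⟩
      refine ⟨{H | ∃ F ∈ S, ∃ G ∈ T, (∃ d, IsMultiHom F d) ∧ (∃ d, IsMultiHom G d) ∧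
        H = F * G}, ?_⟩
      ext x
      constructor
      · intro hx
        by_contra hcon
        simp only [Set.mem_union, not_or, zeroLocus, Set.mem_ofPred_eq, not_forall] at hcon
        obtain ⟨⟨F, hF, d, hd, hF0⟩, ⟨G, hG, e, he, hG0⟩⟩ := hcon
        have h := hx (F * G) ⟨F, hF, G, hG, ⟨d, hd⟩, ⟨e, he⟩, rfl⟩ (d + e)
          (MvPolynomial.IsWeightedHomogeneous.mul hd he)
        simp only [evalAt, map_mul, mul_eq_zero] at h
        exact h.elim hF0 hG0
      · rintro hx H ⟨F, hF, G, hG, ⟨d, hd⟩, ⟨e, he⟩, rfl⟩ c -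
        simp only [evalAt, map_mul, mul_eq_zero]
        exact hx.imp (fun h => h F hF d hd) (fun h => h G hG e he))

variable {κ' : Type} {ι' : κ' → Type}

/-- `f` is a regular function on the (relatively open) subset `U` of the algebraic set `X`: near
every point of `U` it is a quotient of two multihomogeneous polynomials of equal multidegree.
Values of `f` outside `U` play no role. (Requiring the equality on all of `{G ≠ 0} ∩ U` instead of
on a smaller neighbourhood is no restriction, since one may multiply `F` and `G` by a third
polynomial.) -/
def IsRegularOn (X : Set (MultiProj ι)) (U : Set X) (f : X → ℂ) : Prop :=
  ∀ x ∈ U, ∃ (d : κ → ℕ) (F G : MvPolynomial (Σ k, ι k) ℂ),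
    IsMultiHom F d ∧ IsMultiHom G d ∧ evalAt x.1 G ≠ 0 ∧
      ∀ y ∈ U, evalAt y.1 G ≠ 0 → f y = evalAt y.1 F / evalAt y.1 G

/-- A morphism of varieties: a Zariski-continuous map that pulls back regular functions on open
subsets to regular functions. -/
def IsMorphism (X : Set (MultiProj ι)) (Y : Set (MultiProj ι')) (φ : X → Y) : Prop :=
  Continuous φ ∧ ∀ V : Set Y, IsOpen V → ∀ g : Y → ℂ,
    IsRegularOn Y V g → IsRegularOn X (φ ⁻¹' V) (g ∘ φ)

/-- Isomorphism of varieties. -/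
def Isomorphic (X : Set (MultiProj ι)) (Y : Set (MultiProj ι')) : Prop :=
  ∃ e : X ≃ Y, IsMorphism X Y e ∧ IsMorphism Y X e.symm

end MultiProj

/-! ### Toric varieties of polytopes -/

section Toric

variable {I : Type}

/-- The integer points of a subset of `ℝ^I`. -/
def latticePoints (Q : Set (I → ℝ)) : Set (I → ℤ) := {m | (fun i => (m i : ℝ)) ∈ Q}

/-- `Q` is the convex hull of a nonempty finite set of integer points. -/
def IsLatticePolytope (Q : Set (I → ℝ)) : Prop :=
  ∃ S : Finset (I → ℤ), S.Nonempty ∧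
    Q = convexHull ℝ ((fun (m : I → ℤ) (i : I) => (m i : ℝ)) '' (S : Set (I → ℤ)))

/-- A lattice polytope `Q` is normal if for all `k > 0` every integer point of `kQ` is a sum of `k`
integer points of `Q`. -/
def IsNormalLatticePolytope (Q : Set (I → ℝ)) : Prop :=
  IsLatticePolytope Q ∧ ∀ k : ℕ, 0 < k → ∀ m ∈ latticePoints ((k : ℝ) • Q),
    ∃ y : Fin k → I → ℤ, (∀ j, y j ∈ latticePoints Q) ∧ m = ∑ j, y j

variable [Fintype I]

/-- The projective toric variety of a set `A` of integer points: the Zariski closure in `ℙ(ℂ^A)`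
of the set of points `[∏ᵢ tᵢ ^ mᵢ]_{m ∈ A}`, where `t` runs over the torus `(ℂ^*)^I`. -/
def projToricVariety (A : Set (I → ℤ)) : Set (MultiProj (fun _ : Unit => A)) :=
  closure {y | ∃ (t : I → ℂˣ) (h : (fun m : A => ((∏ i, t i ^ m.1 i : ℂˣ) : ℂ)) ≠ 0),
    y = fun _ => Projectivization.mk ℂ _ h}

/-- `X` is isomorphic to the toric variety associated with the rational polytope `Q`, i.e. to
the projective toric variety of the integer points of `kQ`, where `k > 0` is any integer such that
`kQ` is a normal lattice polytope. (The isomorphism class does not depend on `k`; we ask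
that such a `k` exists and that `X` is isomorphic to the variety obtained from each of them.) -/
def IsIsoToToricVariety {κ : Type} {ι : κ → Type} (X : Set (MultiProj ι)) (Q : Set (I → ℝ)) :
    Prop :=
  (∃ k : ℕ, 0 < k ∧ IsNormalLatticePolytope ((k : ℝ) • Q)) ∧
    ∀ k : ℕ, 0 < k → IsNormalLatticePolytope ((k : ℝ) • Q) →
      MultiProj.Isomorphic X (projToricVariety (latticePoints ((k : ℝ) • Q)))

end Toric

/-! ### Marked order polytopes -/

/-- The marked order polytope of the poset `(E, ll)` with marked elements `M` and marking `lam`: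
`x p = lam p` on `M`, and `x p ≥ x q` whenever `p ≪ q`. -/
def markedOrderPolytope {E : Type} (ll : E → E → Prop) (M : Set E) (lam : M → ℝ) :
    Set (E → ℝ) :=
  {x | (∀ p : M, x p = lam p) ∧ ∀ p q, ll p q → x q ≤ x p}

/-! ### The lattice of Plücker indices and Hibi ideals -/

/-- The `(k+1)`-element index sequences `i₁ < ⋯ < i_{k+1}` in `{1, …, n}` (here numbered from `0`).
They index the basis `e_{i₁} ∧ ⋯ ∧ e_{i_{k+1}}` of `∧^{k+1} ℂ^n`. -/
abbrev PluckerIndex (n : ℕ) (k : Fin (n - 1)) : Type := Fin (k.1 + 1) ↪o Fin n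

/-- The set `𝓛` of all `a_{i₁,…,i_k}` with `1 ≤ k ≤ n - 1` and `i₁ < ⋯ < i_k`. The first component
of an element is `k - 1`, the second one is the sequence. -/
def FlagLattice (n : ℕ) : Type := Σ k : Fin (n - 1), PluckerIndex n k

namespace FlagLattice

variable {n : ℕ}

/-- `a_{i₁,…,i_k} ≤ a_{i'₁,…,i'_l}` iff `k ≥ l` and `i_j ≤ i'_j` for all `j ≤ l`. -/
instance : LE (FlagLattice n) :=
  ⟨fun a b => ∃ h : b.1 ≤ a.1, ∀ j : Fin (b.1.1 + 1),
    a.2 (Fin.castLE (Nat.succ_le_succ h) j) ≤ b.2 j⟩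

instance : PartialOrder (FlagLattice n) where
  le_refl a := ⟨le_rfl, fun _ => le_rfl⟩
  le_trans a b c := by
    rintro ⟨h, hh⟩ ⟨g, hg⟩
    exact ⟨g.trans h, fun j => (hh (Fin.castLE (Nat.succ_le_succ g) j)).trans (hg j)⟩
  le_antisymm a b := by
    obtain ⟨k, f⟩ := a
    obtain ⟨l, g⟩ := b
    rintro ⟨h, hh⟩ ⟨h', hh'⟩
    obtain rfl : k = l := le_antisymm h' h
    have : f = g := by
      ext j
      exact congrArg Fin.val (le_antisymm (hh j) (hh' j))
    rw [this]

/-- The join: entrywise maxima, cut off at the length of the shorter sequence. -/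
def join (a b : FlagLattice n) : FlagLattice n :=
  ⟨min a.1 b.1, OrderEmbedding.ofStrictMono
    (fun j => max (a.2 (Fin.castLE (Nat.succ_le_succ (min_le_left a.1 b.1)) j))
      (b.2 (Fin.castLE (Nat.succ_le_succ (min_le_right a.1 b.1)) j)))
    (fun _ _ hij => max_lt_max (a.2.strictMono hij) (b.2.strictMono hij))⟩

theorem lt_of_lt_max (a b : FlagLattice n) {j : ℕ} (hj : j < (max a.1 b.1).1 + 1)
    (ha : ¬ j < a.1.1 + 1) : j < b.1.1 + 1 := by
  rcases le_total a.1 b.1 with h | h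
  · rwa [max_eq_right h] at hj
  · rw [max_eq_left h] at hj
    exact absurd hj ha

/-- Entrywise minima, followed by the remaining entries of the longer sequence. -/
def meetSeq (a b : FlagLattice n) (j : Fin ((max a.1 b.1).1 + 1)) : Fin n :=
  if ha : j.1 < a.1.1 + 1 then
    if hb : j.1 < b.1.1 + 1 then min (a.2 ⟨j, ha⟩) (b.2 ⟨j, hb⟩) else a.2 ⟨j, ha⟩
  else b.2 ⟨j, lt_of_lt_max a b j.2 ha⟩

theorem meetSeq_strictMono (a b : FlagLattice n) : StrictMono (meetSeq a b) := by
  intro i j hij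
  have hij' : i.1 < j.1 := hij
  have hA : ∀ (h1 : i.1 < a.1.1 + 1) (h2 : j.1 < a.1.1 + 1), a.2 ⟨i, h1⟩ < a.2 ⟨j, h2⟩ :=
    fun _ _ => a.2.strictMono hij'
  have hB : ∀ (h1 : i.1 < b.1.1 + 1) (h2 : j.1 < b.1.1 + 1), b.2 ⟨i, h1⟩ < b.2 ⟨j, h2⟩ :=
    fun _ _ => b.2.strictMono hij'
  have hj := fun h => lt_of_lt_max a b j.2 h
  unfold meetSeq
  split_ifs with h1 h2 h3 h4 h5 h6 h7
  any_goals first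
    | exact min_lt_min (hA _ _) (hB _ _)
    | exact (min_le_left _ _).trans_lt (hA _ _)
    | exact (min_le_right _ _).trans_lt (hB _ _)
    | exact hA _ _
    | exact hB _ _
    | (exfalso; omega)

/-- The meet of `a` and `b`. -/
def meet (a b : FlagLattice n) : FlagLattice n :=
  ⟨max a.1 b.1, OrderEmbedding.ofStrictMono (meetSeq a b) (meetSeq_strictMono a b)⟩

instance : Lattice (FlagLattice n) where
  sup := join
  inf := meet
  le_sup_left a b := ⟨min_le_left a.1 b.1, fun _ => le_max_left _ _⟩
  le_sup_right a b := ⟨min_le_right a.1 b.1, fun _ => le_max_right _ _⟩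
  sup_le a b c := by
    rintro ⟨h, hh⟩ ⟨g, hg⟩
    exact ⟨le_min h g, fun j => max_le (hh j) (hg j)⟩
  inf_le_left a b := by
    refine ⟨le_max_left a.1 b.1, fun j => ?_⟩
    have hj := j.2
    change meetSeq a b ⟨j.1, _⟩ ≤ a.2 j
    unfold meetSeq
    rw [dif_pos hj]
    split_ifs
    · exact min_le_left _ _
    · exact le_rfl
  inf_le_right a b := by
    refine ⟨le_max_right a.1 b.1, fun j => ?_⟩
    have hj := j.2
    change meetSeq a b ⟨j.1, _⟩ ≤ b.2 j
    unfold meetSeq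
    split_ifs
    · exact min_le_right _ _
    · exact le_rfl
  le_inf a b c := by
    rintro ⟨h, hh⟩ ⟨g, hg⟩
    refine ⟨max_le h g, fun j => ?_⟩
    change _ ≤ meetSeq b c j
    unfold meetSeq
    split_ifs with h1 h2
    · exact le_min (hh ⟨j, h1⟩) (hg ⟨j, h2⟩)
    · exact hh ⟨j, h1⟩
    · exact hg ⟨j, lt_of_lt_max b c j.2 h1⟩

end FlagLattice

/-- The elements `X_a X_b - X_{a ∨ b} X_{a ∧ b}` for `a`, `b` in the sublattice `M` of `L`. -/
def hibiRelations {L : Type} [Lattice L] (M : Set L) : Set (MvPolynomial L ℂ) :=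
  {F | ∃ a ∈ M, ∃ b ∈ M, F = MvPolynomial.X a * MvPolynomial.X b -
    MvPolynomial.X (a ⊔ b) * MvPolynomial.X (a ⊓ b)}

/-- The Hibi ideal of the lattice `L`. -/
def hibiIdeal (L : Type) [Lattice L] : Ideal (MvPolynomial L ℂ) :=
  Ideal.span (hibiRelations (Set.univ : Set L))

/-! ### The Gelfand-Tsetlin poset -/

/-- The set of all `p_{r,s}`, `1 ≤ r ≤ s ≤ n` (numbered from `0`), with the order
`p_{r,s} ≤ p_{u,v}` iff `r ≤ u` and `s ≤ v`. -/
abbrev GTBar (n : ℕ) : Type := {p : Fin n × Fin n // p.1 ≤ p.2}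

/-- The poset `P` of all `p_{r,s}` other than `p_{1,1}` and `p_{n,n}`, with the induced order. -/
abbrev GTPoset (n : ℕ) : Type :=
  {p : GTBar n // ¬ (p.1.1.1 = 0 ∧ p.1.2.1 = 0) ∧ ¬ (p.1.1.1 + 1 = n ∧ p.1.2.1 + 1 = n)}

/-- The extension of an order on `P` to all `p_{r,s}` that makes `p_{1,1}` the unique minimal and
`p_{n,n}` the unique maximal element. -/
def extendOrder {n : ℕ} (lt : GTPoset n → GTPoset n → Prop) (p q : GTBar n) : Prop :=
  (∃ (hp : _) (hq : _), lt ⟨p, hp⟩ ⟨q, hq⟩) ∨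
    (p ≠ q ∧ p.1.1.1 = 0 ∧ p.1.2.1 = 0) ∨ (p ≠ q ∧ q.1.1.1 + 1 = n ∧ q.1.2.1 + 1 = n)

/-- The marked elements `p_{r,r}`. -/
def gtMarked (n : ℕ) : Set (GTBar n) := {p | p.1.1 = p.1.2}

/-- The marking `p_{r,r} ↦ (n - r) / (n - 1)`, where `1 ≤ r ≤ n`; the coordinate stored in `Fin n` is `r - 1`. -/
def gtMarking (n : ℕ) : gtMarked n → ℝ :=
  fun p => ((n : ℝ) - ((p.1.1.1.1 : ℝ) + 1)) / ((n : ℝ) - 1)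

/-- The identification `ι` of elements of `𝓛` with order ideals in `P`: the order ideal of
`a_{i₁,…,i_k}` consists of `p_{1,n-j+1}, …, p_{i_j-j,n-j+1}` for `1 ≤ j ≤ k` and all `p_{r,s}` with
`s < n - k + 1`. (With numbering from `0`: `s = n - 1 - j` and `r < i_j - j`, respectively
`s < n - k`.) -/
def flagIdeal {n : ℕ} (a : FlagLattice n) : Set (GTPoset n) :=
  {p | (∃ j : Fin (a.1.1 + 1), p.1.1.2.1 + j.1 + 1 = n ∧ p.1.1.1.1 + j.1 < (a.2 j).1) ∨
    p.1.1.2.1 + (a.1.1 + 1) < n}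

/-- The sublattice of those `a` for which `ι(a)` is an order ideal with respect to `lt`. -/
def idealSublattice {n : ℕ} (lt : GTPoset n → GTPoset n → Prop) : Set (FlagLattice n) :=
  {a | ∀ p q, lt p q → q ∈ flagIdeal a → p ∈ flagIdeal a}

/-- The ideal generated by the Hibi ideal of the sublattice `idealSublattice lt` and all variables
`X_a` with `a` outside of the sublattice. -/
def strongerIdeal {n : ℕ} (lt : GTPoset n → GTPoset n → Prop) :
    Ideal (MvPolynomial (FlagLattice n) ℂ) :=
  Ideal.span (hibiRelations (idealSublattice lt) ∪
    {F | ∃ a, a ∉ idealSublattice lt ∧ F = MvPolynomial.X a})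

/-- The subvariety of `ℙ(∧^1 ℂ^n) × ⋯ × ℙ(∧^{n-1} ℂ^n)` cut out by an ideal `J` in the variables
`X_{i₁,…,i_k}`, where `X_{i₁,…,i_k}` is the homogeneous coordinate on `ℙ(∧^k ℂ^n)` that belongs
to `e_{i₁} ∧ ⋯ ∧ e_{i_k}`. -/
def multVariety {n : ℕ} (J : Ideal (MvPolynomial (FlagLattice n) ℂ)) :
    Set (MultiProj (PluckerIndex n)) :=
  MultiProj.zeroLocus {F : MvPolynomial (FlagLattice n) ℂ | F ∈ J}

end

/-! An element `a` of the lattice is encoded by the 0/1 vector `flagVector a` of its order ideal,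
enlarged by `p_{1,1}`. Join and meet become union and intersection, so each Hibi binomial expresses
a relation `χ(a ∨ b) + χ(a ∧ b) = χ(a) + χ(b)`. Conversely, Hibi relations straighten a monomial
into a chain determined by the sum of its vectors. Hence the subvariety is the zero set of all
multihomogeneous binomials between monomials in the sublattice with equal vector sums, together with
the excluded coordinates (`multVariety_strongerIdeal_eq`).

Such a locus is embedded by the monomials of one multidegree `D` in which every factor occurs, with
equal monomials on the locus identified. The image is the projective toric variety of all vector
sums of multidegree `D` (`isomorphic_projToricVariety`), because that variety is itself cut out by
binomials (`mem_projToricVariety_iff`).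

It remains to identify these sums with lattice points. The marking `1/(n-1)` forces the dilation
factor to be `k = c(n-1)`. An integer point of the dilated polytope decomposes into the indicators
of its superlevel sets, which are order ideals; the marked values fix their degrees, each occurring
`c` times (`integralPatterns_eq`). Grouping the layers gives normality, and averaging the roundings
of `x + θ` shows that the polytope is the hull of its integer points (`mem_convexHull_of_floor`). -/

noncomputable section

/-! ### Morphisms given locally by multihomogeneous polynomials. -/

namespace MultiProj

variable {κ κ' : Type} {ι : κ → Type} {ι' : κ' → Type}

theorem IsMultiHom.eval_smul [Fintype κ] {F : MvPolynomial (Σ k, ι k) ℂ} {d : κ → ℕ}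
    (hF : IsMultiHom F d) (c : κ → ℂ) (v : (Σ k, ι k) → ℂ) :
    MvPolynomial.eval (fun s => c s.1 * v s) F = (∏ k, c k ^ d k) * MvPolynomial.eval v F := by
  classical
  rw [MvPolynomial.eval_eq, MvPolynomial.eval_eq, Finset.mul_sum]
  refine Finset.sum_congr rfl fun σ hσ => ?_
  have hw := hF (MvPolynomial.mem_support_iff.mp hσ)
  have hd : ∀ k, d k = ∑ s ∈ σ.support, if s.1 = k then σ s else 0 := by
    intro k
    rw [← hw, Finsupp.weight_apply, Finsupp.sum, Finset.sum_apply]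
    refine Finset.sum_congr rfl fun s _ => ?_
    by_cases h : s.1 = k
    · subst h; simp
    · simp [h, Ne.symm h]
  have : ∏ k, c k ^ d k = ∏ s ∈ σ.support, c s.1 ^ σ s := by
    simp_rw [hd, ← Finset.prod_pow_eq_pow_sum]
    rw [Finset.prod_comm]
    refine Finset.prod_congr rfl fun s _ => ?_
    rw [Finset.prod_eq_single s.1]
    · simp
    · intro k _ hk
      simp [Ne.symm hk]
    · simp
  simp only [mul_pow, Finset.prod_mul_distrib, this]
  ring

open Classical in
theorem isMultiHom_X (s : Σ k, ι k) :
    IsMultiHom (MvPolynomial.X s : MvPolynomial (Σ k, ι k) ℂ) (Pi.single s.1 1) :=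
  MvPolynomial.isWeightedHomogeneous_X ℂ (fun s : Σ k, ι k => (Pi.single s.1 1 : κ → ℕ)) s

theorem IsMultiHom.bind₁ {F : MvPolynomial (Σ k, ι' k) ℂ} {d : κ' → ℕ} [Fintype κ']
    (hF : IsMultiHom F d) {P : (Σ k, ι' k) → MvPolynomial (Σ k, ι k) ℂ} {e : κ' → κ → ℕ}
    (hP : ∀ s, IsMultiHom (P s) (e s.1)) :
    IsMultiHom (MvPolynomial.bind₁ P F) (∑ k, d k • e k) := by
  classical
  rw [MvPolynomial.as_sum F, map_sum]
  refine MvPolynomial.IsWeightedHomogeneous.sum _ _ _ fun σ hσ => ?_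
  have hw := hF (MvPolynomial.mem_support_iff.mp hσ)
  rw [MvPolynomial.bind₁_monomial]
  refine MvPolynomial.IsWeightedHomogeneous.C_mul ?_ _
  have : ∑ k, d k • e k = ∑ s ∈ σ.support, σ s • e s.1 := by
    rw [← hw, Finsupp.weight_apply, Finsupp.sum]
    simp only [Finset.sum_apply, Finset.sum_smul]
    rw [Finset.sum_comm]
    refine Finset.sum_congr rfl fun s _ => ?_
    rw [Finset.sum_eq_single s.1]
    · simp
    · intro k _ hk
      simp [hk]
    · simp
  rw [this]
  exact MvPolynomial.IsWeightedHomogeneous.prod _ _ _ fun s _ => (hP s).pow _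

/-- On the points of `X` where `G` does not vanish, the polynomials `P` are homogeneous coordinates
of the images under `φ`. -/
structure IsChart (X : Set (MultiProj ι)) (Y : Set (MultiProj ι')) (φ : X → Y)
    (P : (Σ k, ι' k) → MvPolynomial (Σ k, ι k) ℂ) (e : κ' → κ → ℕ)
    (G : MvPolynomial (Σ k, ι k) ℂ) (g : κ → ℕ) : Prop where
  multiHom : ∀ s, IsMultiHom (P s) (e s.1)
  multiHom_denom : IsMultiHom G g
  eval_eq : ∀ y : X, evalAt y.1 G ≠ 0 → ∃ c : κ' → ℂ, (∀ k, c k ≠ 0) ∧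
    ∀ s, evalAt y.1 (P s) = c s.1 * ((φ y).1 s.1).rep s.2

/-- The scalar depends on the multidegree of `F` only, so pulling back along a chart preserves both
zeros and quotients of polynomials of equal multidegree. -/
theorem IsChart.evalAt_bind₁ {X : Set (MultiProj ι)} {Y : Set (MultiProj ι')} {φ : X → Y}
    {P : (Σ k, ι' k) → MvPolynomial (Σ k, ι k) ℂ} {e : κ' → κ → ℕ}
    {G : MvPolynomial (Σ k, ι k) ℂ} {g : κ → ℕ} [Fintype κ'] (h : IsChart X Y φ P e G g) (y : X)
    (hy : evalAt y.1 G ≠ 0) : ∃ c : κ' → ℂ, (∀ k, c k ≠ 0) ∧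
      ∀ (F : MvPolynomial (Σ k, ι' k) ℂ) (d : κ' → ℕ), IsMultiHom F d →
        evalAt y.1 (MvPolynomial.bind₁ P F) = (∏ k, c k ^ d k) * evalAt (φ y).1 F := by
  obtain ⟨c, hc, hcP⟩ := h.eval_eq y hy
  refine ⟨c, hc, fun F d hF => ?_⟩
  have := hF.eval_smul c (fun s => ((φ y).1 s.1).rep s.2)
  unfold evalAt at *
  rw [← this, ← MvPolynomial.eval₂_id, ← MvPolynomial.coe_eval₂Hom,
    MvPolynomial.eval₂Hom_bind₁]
  simp only [MvPolynomial.coe_eval₂Hom, MvPolynomial.eval₂_id]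
  congr 2
  funext s
  exact hcP s

theorem isClosed_iff_zeroLocus {C : Set (MultiProj ι)} : IsClosed C ↔ ∃ S, zeroLocus S = C := by
  rw [← isOpen_compl_iff]
  change Cᶜᶜ ∈ Set.range _ ↔ _
  rw [compl_compl, Set.mem_range]

theorem isClosed_zeroLocus (S : Set (MvPolynomial (Σ k, ι k) ℂ)) : IsClosed (zeroLocus S) :=
  isClosed_iff_zeroLocus.2 ⟨S, rfl⟩

/-- A map that is locally given by multihomogeneous polynomials is a morphism. -/
theorem isMorphism_of_charts [Fintype κ'] {X : Set (MultiProj ι)} {Y : Set (MultiProj ι')}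
    {φ : X → Y}
    (h : ∀ x : X, ∃ P e G g, IsChart X Y φ P e G g ∧ evalAt x.1 G ≠ 0) : IsMorphism X Y φ := by
  refine ⟨continuous_iff_isClosed.2 fun C hC => ?_, fun V _ f hf x hx => ?_⟩
  · obtain ⟨D, hD, rfl⟩ := isClosed_induced_iff.1 hC
    obtain ⟨S, rfl⟩ := isClosed_iff_zeroLocus.1 hD
    -- The preimage is cut out by the pullbacks along all charts simultaneously. The factor `G`
    -- makes each equation hold trivially where its chart gives no information.
    refine isClosed_induced_iff.2 ⟨zeroLocus {H | ∃ P e G g, IsChart X Y φ P e G g ∧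
      ∃ F ∈ S, ∃ d, IsMultiHom F d ∧ H = G * MvPolynomial.bind₁ P F}, isClosed_zeroLocus _, ?_⟩
    ext x
    constructor
    · intro hx F hF d hd
      obtain ⟨P, e, G, g, hch, hG⟩ := h x
      obtain ⟨c, hc, hcF⟩ := hch.evalAt_bind₁ x hG
      have h0 := hx (G * MvPolynomial.bind₁ P F) ⟨P, e, G, g, hch, F, hF, d, hd, rfl⟩ _
        (hch.multiHom_denom.mul (hd.bind₁ hch.multiHom))
      have h1 : evalAt x.1 (MvPolynomial.bind₁ P F) = 0 := by
        rw [evalAt, map_mul] at h0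
        exact (mul_eq_zero.1 h0).resolve_left hG
      rw [hcF F d hd] at h1
      exact (mul_eq_zero.1 h1).resolve_left
        (Finset.prod_ne_zero_iff.2 fun k _ => pow_ne_zero _ (hc k))
    · rintro hx _ ⟨P, e, G, g, hch, F, hF, d, hd, rfl⟩ d' -
      rw [evalAt, map_mul]
      by_cases hG : evalAt x.1 G = 0
      · exact mul_eq_zero_of_left hG _
      · obtain ⟨c, hc, hcF⟩ := hch.evalAt_bind₁ x hG
        refine mul_eq_zero_of_right _ ?_
        have := hcF F d hd
        rw [hx F hF d hd, mul_zero] at this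
        exact this
  · obtain ⟨d, F, H, hF, hH, hH0, hfr⟩ := hf (φ x) hx
    obtain ⟨P, e, G, g, hch, hG⟩ := h x
    have hne : ∀ c : κ' → ℂ, (∀ k, c k ≠ 0) → ∏ k, c k ^ d k ≠ 0 := fun c hc =>
      Finset.prod_ne_zero_iff.2 fun k _ => pow_ne_zero _ (hc k)
    -- With `G` in numerator and denominator, a nonvanishing denominator already implies that the
    -- chart is valid at the point.
    refine ⟨_, G * MvPolynomial.bind₁ P F, G * MvPolynomial.bind₁ P H,
      hch.multiHom_denom.mul (hF.bind₁ hch.multiHom),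
      hch.multiHom_denom.mul (hH.bind₁ hch.multiHom), ?_, fun y hy hy0 => ?_⟩
    · obtain ⟨c, hc, hcF⟩ := hch.evalAt_bind₁ x hG
      rw [evalAt, map_mul]
      refine mul_ne_zero hG ?_
      have := hcF H d hH
      rw [evalAt] at this
      rw [this]
      exact mul_ne_zero (hne c hc) hH0
    · rw [evalAt, map_mul] at hy0
      have hGy : evalAt y.1 G ≠ 0 := left_ne_zero_of_mul hy0
      obtain ⟨c, hc, hcF⟩ := hch.evalAt_bind₁ y hGy
      have e1 := hcF F d hF
      have e2 := hcF H d hH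
      have h2 : evalAt y.1 (MvPolynomial.bind₁ P H) ≠ 0 := right_ne_zero_of_mul hy0
      rw [e2] at h2
      have e3 : ∀ K, evalAt y.1 (G * K) = evalAt y.1 G * evalAt y.1 K := fun K => map_mul _ _ _
      rw [Function.comp_apply, hfr (φ y) hy (right_ne_zero_of_mul h2), e3, e3, e1, e2,
        mul_div_mul_left _ _ hGy, mul_div_mul_left _ _ (hne c hc)]

end MultiProj

namespace MultiProj

variable {κ : Type} {ι : κ → Type}

theorem isMultiHom_multiset_prod [DecidableEq κ] (u : Multiset (Σ k, ι k)) {d : κ → ℕ}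
    (hd : ∀ k, d k = (u.map Sigma.fst).count k) : IsMultiHom (u.map MvPolynomial.X).prod d := by
  obtain rfl : d = fun k => (u.map Sigma.fst).count k := funext hd
  clear hd
  induction u using Multiset.induction_on with
  | empty => exact MvPolynomial.isWeightedHomogeneous_one ℂ _
  | cons a u ih =>
    rw [Multiset.map_cons, Multiset.prod_cons]
    have h := (isMultiHom_X a).mul ih
    have e : (fun k => ((a ::ₘ u).map Sigma.fst).count k) =
        @Pi.single κ (fun _ => ℕ) _ (fun a b => Classical.propDecidable (a = b)) a.1 1 +
          fun k => (u.map Sigma.fst).count k := by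
      funext k
      by_cases hk : k = a.1
      · subst hk; simp [add_comm]
      · simp [hk]
    rw [e]
    exact h

theorem evalAt_multiset_prod (x : MultiProj ι) (u : Multiset (Σ k, ι k)) :
    evalAt x (u.map MvPolynomial.X).prod = (u.map fun s => (x s.1).rep s.2).prod := by
  rw [evalAt, map_multiset_prod, Multiset.map_map]
  congr 2
  funext s
  simp

end MultiProj

open MultiProj

/-! ### Binomial equations of projective toric varieties. -/

section Toric

variable {I : Type} [Fintype I]

/-- The character `t ↦ ∏ᵢ tᵢ ^ mᵢ` of the torus, with values in `ℂ`. -/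
def torusCharacter (m : I → ℤ) : (I → ℂˣ) →* ℂ where
  toFun t := ((∏ i, t i ^ m i : ℂˣ) : ℂ)
  map_one' := by simp
  map_mul' s t := by simp [mul_zpow, Finset.prod_mul_distrib]

theorem torusCharacter_zero : torusCharacter (0 : I → ℤ) = 1 := by
  ext t
  simp [torusCharacter]

theorem torusCharacter_add (m m' : I → ℤ) (t : I → ℂˣ) :
    torusCharacter (m + m') t = torusCharacter m t * torusCharacter m' t := by
  simp [torusCharacter, zpow_add, Finset.prod_mul_distrib]

theorem torusCharacter_injective :
    Function.Injective (torusCharacter : (I → ℤ) → (I → ℂˣ) →* ℂ) := by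
  classical
  intro m m' h
  funext i
  have h2 := DFunLike.congr_fun h (Pi.mulSingle i (Units.mk0 2 two_ne_zero))
  -- The torus element equal to 2 in position `i` and 1 elsewhere detects the exponent `m i`.
  have key : ∀ m : I → ℤ, torusCharacter m (Pi.mulSingle i (Units.mk0 2 two_ne_zero)) =
      ((2 : ℝ) ^ m i : ℝ) := by
    intro m
    simp only [torusCharacter, MonoidHom.coe_mk, OneHom.coe_mk]
    rw [Finset.prod_eq_single i]
    · simp
    · intro j _ hj
      simp [Pi.mulSingle_eq_of_ne hj]
    · simp
  rw [key, key] at h2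
  exact zpow_right_injective₀ two_pos (by norm_num) (Complex.ofReal_injective h2)

theorem torusCharacter_multiset_sum {B : Type} (f : B → I → ℤ) (u : Multiset B) (t : I → ℂˣ) :
    (u.map fun b => torusCharacter (f b) t).prod = torusCharacter (u.map f).sum t := by
  induction u using Multiset.induction_on with
  | empty => simp [torusCharacter_zero]
  | cons a u ih => simp [ih, torusCharacter_add]

/-- A linear combination of characters vanishes on the torus only if it vanishes after
identification of equal characters. -/
theorem sum_fiber_eq_zero_of_character_sum {B : Type} [DecidableEq I] (s : Finset B) (c : B → ℂ)
    (w : B → I → ℤ) (h : ∀ t, ∑ b ∈ s, c b * torusCharacter (w b) t = 0) (m : I → ℤ) :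
    ∑ b ∈ s with w b = m, c b = 0 := by
  classical
  have hli : LinearIndependent ℂ (fun m : I → ℤ => (torusCharacter m : (I → ℂˣ) → ℂ)) :=
    (linearIndependent_monoidHom (I → ℂˣ) ℂ).comp torusCharacter torusCharacter_injective
  by_cases hm : m ∈ s.image w
  · refine linearIndependent_iff'.1 hli (s.image w) (fun m => ∑ b ∈ s with w b = m, c b) ?_ m hm
    funext t
    rw [Finset.sum_apply, Pi.zero_apply, ← h t,
      ← Finset.sum_fiberwise_of_maps_to (fun b hb => Finset.mem_image_of_mem w hb)]
    refine Finset.sum_congr rfl fun m _ => ?_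
    rw [Pi.smul_apply, smul_eq_mul, Finset.sum_mul]
    exact Finset.sum_congr rfl fun b hb => by rw [(Finset.mem_filter.1 hb).2]
  · refine Finset.sum_eq_zero fun b hb => ?_
    rw [Finset.mem_filter] at hb
    exact absurd (hb.2 ▸ Finset.mem_image_of_mem w hb.1) hm

/-- The projective toric variety of `A` is cut out by the binomials that come from the relations
between elements of `A`. -/
theorem mem_projToricVariety_iff (A : Set (I → ℤ)) (z : MultiProj (fun _ : Unit => A)) :
    z ∈ projToricVariety A ↔ ∀ u v : Multiset A, u.card = v.card →
      (u.map Subtype.val).sum = (v.map Subtype.val).sum →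
      (u.map (z ()).rep).prod = (v.map (z ()).rep).prod := by
  classical
  let W : Multiset A → Multiset (Σ _ : Unit, A) := fun u => u.map fun a => ⟨(), a⟩
  have hW : ∀ u (y : MultiProj (fun _ : Unit => A)),
      evalAt y ((W u).map MvPolynomial.X).prod = (u.map (y ()).rep).prod := fun u y => by
    rw [evalAt_multiset_prod, Multiset.map_map]
    rfl
  have hrep : ∀ (t : I → ℂˣ) (h : (fun m : A => ((∏ i, t i ^ m.1 i : ℂˣ) : ℂ)) ≠ 0),
      ∃ c : ℂ, c ≠ 0 ∧ ∀ m : A, (Projectivization.mk ℂ _ h).rep m = c * torusCharacter m.1 t := by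
    intro t h
    obtain ⟨c, hc⟩ := Projectivization.exists_smul_eq_mk_rep ℂ _ h
    exact ⟨c, c.ne_zero, fun m => by rw [← hc]; rfl⟩
  constructor
  · intro hz u v huv hsum
    have hd : ∀ (u : Multiset A) (k : Unit), u.card = ((W u).map Sigma.fst).count k := by
      intro u k
      simp [W, Multiset.map_map]
    have hhom : IsMultiHom (((W u).map MvPolynomial.X).prod - ((W v).map MvPolynomial.X).prod)
        (fun _ : Unit => u.card) :=
      (isMultiHom_multiset_prod (W u) (hd u)).sub
        (isMultiHom_multiset_prod (W v) fun k => huv.trans (hd v k))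
    have hsub : ∀ y : MultiProj (fun _ : Unit => A),
        evalAt y (((W u).map MvPolynomial.X).prod - ((W v).map MvPolynomial.X).prod) =
          (u.map (y ()).rep).prod - (v.map (y ()).rep).prod := fun y => by
      rw [← hW, ← hW]
      exact map_sub _ _ _
    have := closure_minimal (t := zeroLocus
      {((W u).map MvPolynomial.X).prod - ((W v).map MvPolynomial.X).prod}) ?_
      (isClosed_zeroLocus _) hz
    · have := this _ rfl _ hhom
      rwa [hsub, sub_eq_zero] at this
    · rintro _ ⟨t, h, rfl⟩ _ rfl d -
      obtain ⟨c, -, hc⟩ := hrep t h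
      refine (hsub (fun _ => Projectivization.mk ℂ _ h)).trans (sub_eq_zero.2 ?_)
      change (u.map fun m => (Projectivization.mk ℂ _ h).rep m).prod =
        (v.map fun m => (Projectivization.mk ℂ _ h).rep m).prod
      simp only [hc, Multiset.prod_map_mul, Multiset.map_const', Multiset.prod_replicate,
        torusCharacter_multiset_sum, huv, hsum]
  · intro h
    -- The point `z` supplies an element of `A`, so every torus element gives a nonzero vector of
    -- characters.
    obtain ⟨a₀, ha₀⟩ := Function.ne_iff.1 (z ()).rep_nonzero
    rw [projToricVariety, closure, Set.mem_sInter]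
    rintro C ⟨hC, hTC⟩
    obtain ⟨S, rfl⟩ := isClosed_iff_zeroLocus.1 hC
    intro F hF d hd
    have htor : ∀ t : I → ℂˣ, MvPolynomial.eval (fun s => torusCharacter s.2.1 t) F = 0 := by
      intro t
      have hne : (fun m : A => ((∏ i, t i ^ m.1 i : ℂˣ) : ℂ)) ≠ 0 :=
        Function.ne_iff.2 ⟨a₀, Units.ne_zero _⟩
      obtain ⟨c, hc0, hc⟩ := hrep t hne
      have h0 := hTC ⟨t, hne, rfl⟩ F hF d hd
      have h1 := hd.eval_smul (fun _ => c) (fun s => torusCharacter s.2.1 t)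
      simp only [evalAt, hc] at h0
      rw [h0] at h1
      exact (mul_eq_zero.1 h1.symm).resolve_left
        (Finset.prod_ne_zero_iff.2 fun k _ => pow_ne_zero _ hc0)
    let T : ((Σ _ : Unit, A) →₀ ℕ) → Multiset (Σ _ : Unit, A) := fun σ => Finsupp.toMultiset σ
    have hT : ∀ σ (f : (Σ _ : Unit, A) → ℂ), ∏ s ∈ σ.support, f s ^ σ s = ((T σ).map f).prod := by
      intro σ f
      simp [T, Finset.prod_multiset_map_count]
    let w : ((Σ _ : Unit, A) →₀ ℕ) → I → ℤ := fun σ => ((T σ).map fun s => s.2.1).sum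
    -- `F` vanishes on the torus, so by independence of characters its coefficients sum to zero over
    -- each set of monomials with the same character.
    have hfib := sum_fiber_eq_zero_of_character_sum F.support (fun σ => F.coeff σ) w (by
      intro t
      rw [← htor t, MvPolynomial.eval_eq]
      refine Finset.sum_congr rfl fun σ _ => ?_
      rw [hT, torusCharacter_multiset_sum (fun s : Σ _ : Unit, A => s.2.1)])
    rw [evalAt, MvPolynomial.eval_eq,
      ← Finset.sum_fiberwise_of_maps_to (fun b hb => Finset.mem_image_of_mem w hb)]
    refine Finset.sum_eq_zero fun m hm => ?_
    obtain ⟨σ₀, hσ₀, rfl⟩ := Finset.mem_image.1 hm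
    -- The binomial equations say that monomials with the same character agree at `z`; they have
    -- equal degree since `F` is homogeneous.
    have hconst : ∀ σ ∈ F.support.filter (fun σ => w σ = w σ₀),
        ∏ s ∈ σ.support, (z s.1).rep s.2 ^ σ s = ∏ s ∈ σ₀.support, (z s.1).rep s.2 ^ σ₀ s := by
      intro σ hσ
      rw [Finset.mem_filter] at hσ
      have hcard : ∀ σ ∈ F.support, ((T σ).map Sigma.snd).card = d () := by
        intro σ hσ
        have := congrFun (hd (MvPolynomial.mem_support_iff.mp hσ)) ()
        rw [← this, Finsupp.weight_apply, Finsupp.sum, Finset.sum_apply, Multiset.card_map,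
          Finsupp.card_toMultiset]
        exact Finset.sum_congr rfl fun s _ => by simp
      have := h ((T σ).map Sigma.snd) ((T σ₀).map Sigma.snd)
        ((hcard σ hσ.1).trans (hcard σ₀ hσ₀).symm)
        (by rw [Multiset.map_map, Multiset.map_map]; exact hσ.2)
      rw [hT, hT]
      rw [Multiset.map_map, Multiset.map_map] at this
      exact this
    rw [Finset.sum_congr rfl fun σ hσ => by rw [hconst σ hσ], ← Finset.sum_mul, hfib, zero_mul]

end Toric

/-! ### Embedding a multigraded binomial locus by the monomials of one multidegree. -/

namespace MultiProj

variable {κ : Type} {ι : κ → Type} {I : Type}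

/-- The `s`-th coordinate in the chosen homogeneous coordinates of `x`. -/
def coord (x : MultiProj ι) (s : Σ k, ι k) : ℂ := (x s.1).rep s.2

theorem exists_coord_ne_zero (x : MultiProj ι) (k : κ) : ∃ i, coord x ⟨k, i⟩ ≠ 0 :=
  Function.ne_iff.1 (x k).rep_nonzero

/-- The points with `x_s = 0` for all `s` outside of `M` whose coordinates satisfy all
multihomogeneous binomial relations that come from relations between the vectors `χ s`, `s ∈ M`. -/
def binomialLocus (χ : (Σ k, ι k) → I → ℤ) (M : Set (Σ k, ι k)) : Set (MultiProj ι) :=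
  {x | (∀ s ∉ M, coord x s = 0) ∧ ∀ u v : Multiset (Σ k, ι k), (∀ s ∈ u, s ∈ M) →
    (∀ s ∈ v, s ∈ M) → u.map Sigma.fst = v.map Sigma.fst → (u.map χ).sum = (v.map χ).sum →
    (u.map (coord x)).prod = (v.map (coord x)).prod}

/-- The set of all sums of vectors `χ s`, `s ∈ M`, with prescribed multiset of degrees `D`. -/
def degreeSums (χ : (Σ k, ι k) → I → ℤ) (M : Set (Σ k, ι k)) (D : Multiset κ) : Set (I → ℤ) :=
  {m | ∃ u : Multiset (Σ k, ι k), (∀ s ∈ u, s ∈ M) ∧ u.map Sigma.fst = D ∧ (u.map χ).sum = m}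

variable {χ : (Σ k, ι k) → I → ℤ} {M : Set (Σ k, ι k)} {D : Multiset κ}

/-- A multiset of elements of `M` of degree `D` with sum `m`. -/
def decomp (m : degreeSums χ M D) : Multiset (Σ k, ι k) := m.2.choose

theorem mem_of_mem_decomp (m : degreeSums χ M D) : ∀ s ∈ decomp m, s ∈ M := m.2.choose_spec.1

theorem map_fst_decomp (m : degreeSums χ M D) : (decomp m).map Sigma.fst = D :=
  m.2.choose_spec.2.1

theorem sum_decomp (m : degreeSums χ M D) : ((decomp m).map χ).sum = m := m.2.choose_spec.2.2

/-- On the locus the arbitrary choice made in `decomp` does not matter. -/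
theorem prod_coord_eq {x : MultiProj ι} (hx : x ∈ binomialLocus χ M) (m : degreeSums χ M D)
    {u : Multiset (Σ k, ι k)} (hu : ∀ s ∈ u, s ∈ M) (hD : u.map Sigma.fst = D)
    (hm : (u.map χ).sum = m) : ((decomp m).map (coord x)).prod = (u.map (coord x)).prod :=
  hx.2 _ _ (mem_of_mem_decomp m) hu ((map_fst_decomp m).trans hD.symm)
    ((sum_decomp m).trans hm.symm)

/-- Choose a nonvanishing coordinate in each factor; it must belong to `M`. The product of these
coordinates with multiplicities `D` is one of the monomials, and it is nonzero. -/
theorem monomials_ne_zero {x : MultiProj ι} (hx : x ∈ binomialLocus χ M) (D : Multiset κ) :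
    (fun m : degreeSums χ M D => ((decomp m).map (coord x)).prod) ≠ 0 := by
  choose i hi using exists_coord_ne_zero x
  have hM : ∀ k, (⟨k, i k⟩ : Σ k, ι k) ∈ M := fun k => by
    by_contra h
    exact hi k (hx.1 _ h)
  have hu : ∀ s ∈ D.map (fun k => (⟨k, i k⟩ : Σ k, ι k)), s ∈ M := by
    intro s hs
    obtain ⟨k, -, rfl⟩ := Multiset.mem_map.1 hs
    exact hM k
  have hD : (D.map (fun k => (⟨k, i k⟩ : Σ k, ι k))).map Sigma.fst = D := by
    simp [Multiset.map_map]
  refine Function.ne_iff.2 ⟨⟨_, _, hu, hD, rfl⟩, ?_⟩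
  rw [prod_coord_eq hx ⟨_, _, hu, hD, rfl⟩ hu hD rfl, Pi.zero_apply, Multiset.map_map]
  intro h0
  obtain ⟨k, -, hk⟩ := Multiset.mem_map.1 (Multiset.prod_eq_zero_iff.1 h0)
  exact hi k hk

/-- The map to projective space given by all monomials of multidegree `D`. -/
def monomialMap (χ : (Σ k, ι k) → I → ℤ) (M : Set (Σ k, ι k)) (D : Multiset κ)
    (x : binomialLocus χ M) : MultiProj (fun _ : Unit => degreeSums χ M D) :=
  fun _ => Projectivization.mk ℂ _ (monomials_ne_zero x.2 D)

theorem monomialMap_coord (x : binomialLocus χ M) : ∃ c : ℂ, c ≠ 0 ∧ ∀ m : degreeSums χ M D,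
    (monomialMap χ M D x ()).rep m = c * ((decomp m).map (coord x.1)).prod := by
  obtain ⟨c, hc⟩ := Projectivization.exists_smul_eq_mk_rep ℂ _ (monomials_ne_zero x.2 D)
  exact ⟨c, c.ne_zero, fun m => (congrFun hc m).symm⟩

theorem exists_mem_decomp (hD : ∀ k, k ∈ D) (m : degreeSums χ M D) (k : κ) :
    ∃ i, (⟨k, i⟩ : Σ k, ι k) ∈ decomp m := by
  have h := hD k
  rw [← map_fst_decomp m] at h
  obtain ⟨⟨_, i⟩, hi, rfl⟩ := Multiset.mem_map.1 h
  exact ⟨i, hi⟩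

/-- Some element of degree `k` of `decomp m`. -/
def pivot (hD : ∀ k, k ∈ D) (m : degreeSums χ M D) (k : κ) : Σ k, ι k :=
  ⟨k, (exists_mem_decomp hD m k).choose⟩

theorem pivot_mem (hD : ∀ k, k ∈ D) (m : degreeSums χ M D) (k : κ) : pivot hD m k ∈ decomp m :=
  (exists_mem_decomp hD m k).choose_spec

theorem exchange_mem (hD : ∀ k, k ∈ D) (m : degreeSums χ M D) {s : Σ k, ι k} (hs : s ∈ M) :
    m - χ (pivot hD m s.1) + χ s ∈ degreeSums χ M D := by
  obtain ⟨r, hr⟩ := Multiset.exists_cons_of_mem (pivot_mem hD m s.1)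
  have hM := mem_of_mem_decomp m
  have hfst := map_fst_decomp m
  have hsum := sum_decomp m
  rw [hr] at hM hfst hsum
  refine ⟨s ::ₘ r, ?_, ?_, ?_⟩
  · simpa [hs] using fun t ht => hM t (Multiset.mem_cons_of_mem ht)
  · rw [← hfst]
    simp [pivot]
  · rw [← hsum]
    simp [add_comm]

open Classical in
/-- The result of replacing an element of the decomposition of `m` by `s`. -/
def exchange (hD : ∀ k, k ∈ D) (m : degreeSums χ M D) (s : Σ k, ι k) : degreeSums χ M D :=
  if hs : s ∈ M then ⟨_, exchange_mem hD m hs⟩ else m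

theorem coe_exchange (hD : ∀ k, k ∈ D) (m : degreeSums χ M D) {s : Σ k, ι k} (hs : s ∈ M) :
    (exchange hD m s : I → ℤ) = m - χ (pivot hD m s.1) + χ s := by
  rw [exchange, dif_pos hs]

theorem exchange_pivot (hD : ∀ k, k ∈ D) (m : degreeSums χ M D) (k : κ) :
    exchange hD m (pivot hD m k) = m := by
  refine Subtype.ext ?_
  rw [coe_exchange hD m (mem_of_mem_decomp m _ (pivot_mem hD m k))]
  exact sub_add_cancel _ _

/-- Both monomials share the factors left after removing the pivot, and their product `c` does not
depend on `i`. Thus the exchanged monomials are homogeneous coordinates on the `k`-th factor. -/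
theorem exists_prod_exchange (hD : ∀ k, k ∈ D) (m : degreeSums χ M D) {x : MultiProj ι}
    (hx : x ∈ binomialLocus χ M) (k : κ) (h : ((decomp m).map (coord x)).prod ≠ 0) :
    ∃ c : ℂ, c ≠ 0 ∧ ∀ i, (⟨k, i⟩ : Σ k, ι k) ∈ M →
      ((decomp (exchange hD m ⟨k, i⟩)).map (coord x)).prod = c * coord x ⟨k, i⟩ := by
  obtain ⟨r, hr⟩ := Multiset.exists_cons_of_mem (pivot_mem hD m k)
  have hM := mem_of_mem_decomp m
  have hfst := map_fst_decomp m
  have hsum := sum_decomp m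
  rw [hr] at hM hfst hsum h
  refine ⟨(r.map (coord x)).prod, ?_, fun i hi => ?_⟩
  · rw [Multiset.map_cons, Multiset.prod_cons] at h
    exact right_ne_zero_of_mul h
  · rw [prod_coord_eq hx (u := ⟨k, i⟩ ::ₘ r)]
    · simp [mul_comm]
    · simpa [hi] using fun t ht => hM t (Multiset.mem_cons_of_mem ht)
    · rw [← hfst]
      simp [pivot]
    · rw [coe_exchange hD m hi, ← hsum]
      simp [add_comm]

open Classical in
/-- Linear forms that recover the coordinates of a point from its image under `monomialMap`. -/
def inverseForm (hD : ∀ k, k ∈ D) (m : degreeSums χ M D) (s : Σ k, ι k) :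
    MvPolynomial (Σ _ : Unit, degreeSums χ M D) ℂ :=
  if s ∈ M then MvPolynomial.X ⟨(), exchange hD m s⟩ else 0

theorem isMultiHom_X_of_unit {B : Unit → Type} (s : Σ k, B k) :
    IsMultiHom (MvPolynomial.X s : MvPolynomial (Σ k, B k) ℂ) (fun _ => 1) := by
  have h := isMultiHom_multiset_prod {s} (d := fun _ => 1) (fun k => by simp)
  simpa using h

theorem isMultiHom_inverseForm (hD : ∀ k, k ∈ D) (m : degreeSums χ M D) (s : Σ k, ι k) :
    IsMultiHom (inverseForm hD m s) (fun _ => 1) := by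
  unfold inverseForm
  split_ifs
  · exact isMultiHom_X_of_unit _
  · exact MvPolynomial.isWeightedHomogeneous_zero ℂ _ _

theorem evalAt_inverseForm (hD : ∀ k, k ∈ D) (m : degreeSums χ M D) (s : Σ k, ι k)
    (z : MultiProj (fun _ : Unit => degreeSums χ M D)) [Decidable (s ∈ M)] :
    evalAt z (inverseForm hD m s) = if s ∈ M then (z ()).rep (exchange hD m s) else 0 := by
  unfold inverseForm evalAt
  split_ifs <;> simp

theorem exists_evalAt_inverseForm (hD : ∀ k, k ∈ D) (m : degreeSums χ M D)
    (x : binomialLocus χ M) (hm : (monomialMap χ M D x ()).rep m ≠ 0) :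
    ∃ c : κ → ℂ, (∀ k, c k ≠ 0) ∧ ∀ s, evalAt (monomialMap χ M D x) (inverseForm hD m s) =
      c s.1 * coord x.1 s := by
  classical
  obtain ⟨l, hl, hl'⟩ := monomialMap_coord (D := D) x
  rw [hl'] at hm
  choose c hc hcx using fun k => exists_prod_exchange hD m x.2 k (right_ne_zero_of_mul hm)
  refine ⟨fun k => l * c k, fun k => mul_ne_zero hl (hc k), fun s => ?_⟩
  rw [evalAt_inverseForm]
  split_ifs with hs
  · rw [hl', hcx s.1 s.2 hs, mul_assoc]
  · rw [x.2.1 s hs, mul_zero]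

theorem ext_of_coord {x y : MultiProj ι} (c : κ → ℂ) (h : ∀ s, coord x s = c s.1 * coord y s) :
    x = y := by
  funext k
  rw [← (x k).mk_rep, ← (y k).mk_rep, Projectivization.mk_eq_mk_iff']
  exact ⟨c k, funext fun i => (h ⟨k, i⟩).symm⟩

/-- Where the coordinate `m` of the image is nonzero, the linear forms `inverseForm hD m` return the
original coordinates up to one scalar per factor. -/
theorem monomialMap_injective (hD : ∀ k, k ∈ D) :
    Function.Injective (monomialMap χ M D) := by
  intro x y hxy
  obtain ⟨m, hm⟩ := Function.ne_iff.1 (monomialMap χ M D x ()).rep_nonzero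
  obtain ⟨c, hc, hcx⟩ := exists_evalAt_inverseForm hD m x hm
  rw [hxy] at hm hcx
  obtain ⟨d, hd, hdy⟩ := exists_evalAt_inverseForm hD m y hm
  refine Subtype.ext (ext_of_coord (fun k => (c k)⁻¹ * d k) fun s => ?_)
  rw [mul_assoc, ← hdy, hcx, inv_mul_cancel_left₀ (hc _)]

variable [Fintype I]

/-- Replacing every `m` by its decomposition turns a binomial on the image into a binomial on the
locus, with equal degrees and equal vector sums. -/
theorem monomialMap_mem (x : binomialLocus χ M) :
    monomialMap χ M D x ∈ projToricVariety (degreeSums χ M D) := by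
  rw [mem_projToricVariety_iff]
  intro u v huv hsum
  obtain ⟨c, -, hc⟩ := monomialMap_coord (D := D) x
  have key : ∀ u : Multiset (degreeSums χ M D), (u.map (monomialMap χ M D x ()).rep).prod =
      c ^ u.card * ((u.bind decomp).map (coord x.1)).prod := by
    intro u
    change (u.map fun m => (monomialMap χ M D x ()).rep m).prod = _
    simp only [hc, Multiset.prod_map_mul, Multiset.map_const', Multiset.prod_replicate,
      Multiset.map_bind, Multiset.prod_bind]
  have hM : ∀ u : Multiset (degreeSums χ M D), ∀ s ∈ u.bind decomp, s ∈ M := by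
    intro u s hs
    obtain ⟨m, -, hm⟩ := Multiset.mem_bind.1 hs
    exact mem_of_mem_decomp m s hm
  rw [key, key, huv]
  congr 1
  refine x.2.2 _ _ (hM u) (hM v) ?_ ?_
  · have : ∀ u : Multiset (degreeSums χ M D), (u.bind decomp).map Sigma.fst = u.card • D := by
      intro u
      simp only [Multiset.map_bind, map_fst_decomp]
      induction u using Multiset.induction_on with
      | empty => simp
      | cons a u ih => simp [ih, add_smul, add_comm]
    rw [this, this, huv]
  · have : ∀ u : Multiset (degreeSums χ M D),
        ((u.bind decomp).map χ).sum = (u.map Subtype.val).sum := by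
      intro u
      rw [Multiset.map_bind, Multiset.sum_bind]
      simp only [sum_decomp]
    rw [this, this, hsum]

theorem monomialMap_surjOn (hD : ∀ k, k ∈ D) {z : MultiProj (fun _ : Unit => degreeSums χ M D)}
    (hz : z ∈ projToricVariety (degreeSums χ M D)) : ∃ x, monomialMap χ M D x = z := by
  classical
  rw [mem_projToricVariety_iff] at hz
  obtain ⟨m, hm⟩ := Function.ne_iff.1 (z ()).rep_nonzero
  -- The candidate preimage: the coordinate at `s` is the coordinate of `z` at `m` with its pivot of
  -- the same degree exchanged for `s`.
  let w : (Σ k, ι k) → ℂ := fun s => evalAt z (inverseForm hD m s)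
  have hw : ∀ s ∈ M, w s = (z ()).rep (exchange hD m s) := fun s hs => by
    simp only [w, evalAt_inverseForm, if_pos hs]
  have hw0 : ∀ s ∉ M, w s = 0 := fun s hs => by
    simp only [w, evalAt_inverseForm, if_neg hs]
  have hne : ∀ k, (fun i => w ⟨k, i⟩) ≠ 0 := fun k => by
    refine Function.ne_iff.2 ⟨(pivot hD m k).2, ?_⟩
    change w (pivot hD m k) ≠ 0
    rw [hw _ (mem_of_mem_decomp m _ (pivot_mem hD m k)), exchange_pivot]
    exact hm
  let x : MultiProj ι := fun k => Projectivization.mk ℂ _ (hne k)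
  choose a ha using fun k => Projectivization.exists_smul_eq_mk_rep ℂ _ (hne k)
  have hx : ∀ s, coord x s = a s.1 * w s := fun s => (congrFun (ha s.1) s.2).symm
  have hprod : ∀ u : Multiset (Σ k, ι k), (∀ s ∈ u, s ∈ M) → (u.map (coord x)).prod =
      ((u.map Sigma.fst).map fun k => (a k : ℂ)).prod *
        ((u.map (exchange hD m)).map (z ()).rep).prod := by
    intro u hu
    rw [Multiset.map_map, Multiset.map_map, ← Multiset.prod_map_mul]
    exact congrArg _ (Multiset.map_congr rfl fun s hs => by
      rw [hx, hw s (hu s hs)]; rfl)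
  -- Each exchange adds an offset that depends only on the degree, so relations between multisets of
  -- equal degrees carry over to the exchanged vectors.
  have hsum : ∀ u : Multiset (Σ k, ι k), (∀ s ∈ u, s ∈ M) →
      ((u.map (exchange hD m)).map Subtype.val).sum =
        ((u.map Sigma.fst).map fun k => (m - χ (pivot hD m k) : I → ℤ)).sum +
          (u.map χ).sum := by
    intro u hu
    rw [Multiset.map_map, Multiset.map_map, ← Multiset.sum_map_add]
    exact congrArg _ (Multiset.map_congr rfl fun s hs => coe_exchange hD m (hu s hs))
  have hxX : x ∈ binomialLocus χ M := by
    refine ⟨fun s hs => by rw [hx, hw0 s hs, mul_zero], fun u v hu hv hdeg huv => ?_⟩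
    rw [hprod u hu, hprod v hv, hdeg]
    congr 1
    refine hz _ _ ?_ ?_
    · simpa using congrArg Multiset.card hdeg
    · rw [hsum u hu, hsum v hv, hdeg, huv]
  refine ⟨⟨x, hxX⟩, ?_⟩
  funext k
  rw [← (z k).mk_rep]
  refine (Projectivization.mk_eq_mk_iff' ℂ _ _ _ _).2
    ⟨(D.map fun k => (a k : ℂ)).prod *
      (((decomp m).map (exchange hD m)).map (z ()).rep).prod / (z ()).rep m, ?_⟩
  funext m'
  change _ / _ * (z ()).rep m' = ((decomp m').map (coord x)).prod
  rw [hprod _ (mem_of_mem_decomp m'), map_fst_decomp, div_mul_eq_mul_div, div_eq_iff hm]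
  -- Both sums equal `m + m'` plus the offsets of `D`. This one binomial shows that the image of `x`
  -- is proportional to `z`.
  have := hz (m ::ₘ (decomp m').map (exchange hD m)) (m' ::ₘ (decomp m).map (exchange hD m))
    (by
      have h := fun m : degreeSums χ M D => congrArg Multiset.card (map_fst_decomp m)
      simp only [Multiset.card_map] at h
      simp [h])
    (by
      rw [Multiset.map_cons, Multiset.map_cons, Multiset.sum_cons, Multiset.sum_cons,
        hsum _ (mem_of_mem_decomp m'), hsum _ (mem_of_mem_decomp m), map_fst_decomp,
        map_fst_decomp, sum_decomp, sum_decomp]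
      abel)
  rw [Multiset.map_cons, Multiset.map_cons, Multiset.prod_cons, Multiset.prod_cons] at this
  linear_combination -(D.map fun k => (a k : ℂ)).prod * this

/-- The binomial locus is isomorphic to the projective toric variety of all sums of multidegree
`D`, provided that all degrees occur in `D`. -/
theorem isomorphic_projToricVariety [Fintype κ] (hD : ∀ k, k ∈ D) :
    Isomorphic (binomialLocus χ M) (projToricVariety (degreeSums χ M D)) := by
  classical
  let φ : binomialLocus χ M → projToricVariety (degreeSums χ M D) :=
    fun x => ⟨monomialMap χ M D x, monomialMap_mem x⟩
  have hφ : Function.Bijective φ :=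
    ⟨fun x y h => monomialMap_injective hD (congrArg Subtype.val h), fun z =>
      (monomialMap_surjOn hD z.2).imp fun x hx => Subtype.ext hx⟩
  refine ⟨Equiv.ofBijective φ hφ, isMorphism_of_charts fun x => ?_,
    isMorphism_of_charts fun z => ?_⟩
  -- The monomial map needs only one global chart, with denominator 1; its inverse uses a chart `z_m
  -- ≠ 0` for each `m`.
  · refine ⟨fun s => ((decomp s.2).map MvPolynomial.X).prod, fun _ k => D.count k, 1, 0,
      ⟨fun s => isMultiHom_multiset_prod _ fun k => by rw [map_fst_decomp],
        MvPolynomial.isWeightedHomogeneous_one ℂ _, fun y _ => ?_⟩, by simp [evalAt]⟩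
    obtain ⟨c, hc, hcy⟩ := monomialMap_coord (D := D) y
    refine ⟨fun _ => c⁻¹, fun _ => inv_ne_zero hc, fun s => ?_⟩
    rw [evalAt_multiset_prod]
    refine (inv_mul_cancel_left₀ hc _).symm.trans ?_
    exact congrArg (c⁻¹ * ·) (hcy s.2).symm
  · obtain ⟨m, hm⟩ := Function.ne_iff.1 (z.1 ()).rep_nonzero
    have hX : ∀ y : MultiProj (fun _ : Unit => degreeSums χ M D),
        evalAt y (MvPolynomial.X ⟨(), m⟩) = (y ()).rep m := fun y => by simp [evalAt]
    refine ⟨inverseForm hD m, fun _ _ => 1, MvPolynomial.X ⟨(), m⟩, fun _ => 1,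
      ⟨isMultiHom_inverseForm hD m, isMultiHom_X_of_unit _, fun y hy => ?_⟩, by rw [hX]; exact hm⟩
    obtain ⟨x, rfl⟩ := (Equiv.ofBijective φ hφ).surjective y
    rw [Equiv.symm_apply_apply]
    rw [hX] at hy
    exact exists_evalAt_inverseForm hD m x hy

end MultiProj

/-! ### Straightening monomials by Hibi relations. -/

section Straightening

variable {L E : Type}

/-- The characteristic function of the set `C a`. -/
def charVector (C : L → Set E) (a : L) : E → ℤ := (C a).indicator 1

theorem charVector_nonneg (C : L → Set E) (a : L) (p : E) : 0 ≤ charVector C a p :=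
  Set.indicator_nonneg (fun _ _ => zero_le_one) p

theorem charVector_pos_iff (C : L → Set E) (a : L) (p : E) : 0 < charVector C a p ↔ p ∈ C a := by
  by_cases h : p ∈ C a <;> simp [charVector, h]

theorem multiset_sum_apply {B : Type} (f : B → E → ℤ) (u : Multiset B) (p : E) :
    (u.map f).sum p = (u.map fun b => f b p).sum := by
  induction u using Multiset.induction_on with
  | empty => simp
  | cons a u ih => simp [ih]

theorem sum_charVector_nonneg (C : L → Set E) (u : Multiset L) (p : E) :
    0 ≤ (u.map (charVector C)).sum p := by
  rw [multiset_sum_apply]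
  refine Multiset.sum_nonneg fun z hz => ?_
  obtain ⟨a, -, rfl⟩ := Multiset.mem_map.1 hz
  exact charVector_nonneg C a p

variable [Lattice L] {C : L → Set E}

theorem charVector_sup_add_inf (hsup : ∀ a b, C (a ⊔ b) = C a ∪ C b)
    (hinf : ∀ a b, C (a ⊓ b) = C a ∩ C b) (a b : L) :
    charVector C (a ⊔ b) + charVector C (a ⊓ b) = charVector C a + charVector C b := by
  rw [charVector, charVector, hsup, hinf]
  exact Set.indicator_union_add_inter _ _ _

/-- By means of the Hibi relations, the join of all factors can be split off from a monomial. -/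
theorem exists_split_sup (hsup : ∀ a b, C (a ⊔ b) = C a ∪ C b)
    (hinf : ∀ a b, C (a ⊓ b) = C a ∩ C b) {M : Set L} (hM : ∀ a ∈ M, ∀ b ∈ M, a ⊔ b ∈ M ∧ a ⊓ b ∈ M)
    {x : L → ℂ} (hx : ∀ a ∈ M, ∀ b ∈ M, x a * x b = x (a ⊔ b) * x (a ⊓ b)) (u : Multiset L) :
    ∀ a, (∀ b ∈ a ::ₘ u, b ∈ M) → ∃ t ∈ M, ∃ v : Multiset L, (∀ b ∈ v, b ∈ M) ∧
      v.card = u.card ∧ ((a ::ₘ u).map x).prod = x t * (v.map x).prod ∧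
      ((a ::ₘ u).map (charVector C)).sum = charVector C t + (v.map (charVector C)).sum ∧
      ∀ p, p ∈ C t ↔ 0 < ((a ::ₘ u).map (charVector C)).sum p := by
  induction u using Multiset.induction_on with
  | empty =>
    intro a ha
    exact ⟨a, ha a (by simp), 0, by simp, rfl, by simp, by simp, fun p => by
      simp [charVector_pos_iff]⟩
  | cons b u ih =>
    intro a ha
    obtain ⟨t, ht, v, hv, hcard, hprod, hsum, hmem⟩ :=
      ih b fun c hc => ha c (Multiset.mem_cons_of_mem hc)
    have haM := ha a (Multiset.mem_cons_self _ _)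
    -- One relation replaces `a, t` by their join and meet. The meet goes back into the remainder,
    -- which preserves the number of factors and the vector sum.
    refine ⟨a ⊔ t, (hM a haM t ht).1, (a ⊓ t) ::ₘ v, ?_, by simp [hcard], ?_, ?_, fun p => ?_⟩
    · intro c hc
      rcases Multiset.mem_cons.1 hc with rfl | hc
      · exact (hM a haM t ht).2
      · exact hv c hc
    · rw [Multiset.map_cons, Multiset.prod_cons, hprod, ← mul_assoc, hx a haM t ht,
        Multiset.map_cons, Multiset.prod_cons, mul_assoc]
    · rw [Multiset.map_cons, Multiset.sum_cons, hsum, ← add_assoc,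
        ← charVector_sup_add_inf hsup hinf, Multiset.map_cons, Multiset.sum_cons, add_assoc]
    · rw [hsup, Multiset.map_cons, Multiset.sum_cons, Set.mem_union, Pi.add_apply, hmem,
        ← charVector_pos_iff]
      have h1 := charVector_nonneg C a p
      have h2 := sum_charVector_nonneg C (b ::ₘ u) p
      omega

/-- If `x` satisfies the Hibi relations on the sublattice `M`, then monomials in elements of `M`
with the same sum of characteristic functions take the same value at `x`. -/
theorem prod_eq_of_sum_charVector_eq (hsup : ∀ a b, C (a ⊔ b) = C a ∪ C b)
    (hinf : ∀ a b, C (a ⊓ b) = C a ∩ C b) (hinj : Function.Injective C)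
    (p₀ : E) (hp₀ : ∀ a, p₀ ∈ C a)
    {M : Set L} (hM : ∀ a ∈ M, ∀ b ∈ M, a ⊔ b ∈ M ∧ a ⊓ b ∈ M)
    {x : L → ℂ} (hx : ∀ a ∈ M, ∀ b ∈ M, x a * x b = x (a ⊔ b) * x (a ⊓ b))
    (u v : Multiset L) (hu : ∀ a ∈ u, a ∈ M) (hv : ∀ a ∈ v, a ∈ M)
    (h : (u.map (charVector C)).sum = (v.map (charVector C)).sum) :
    (u.map x).prod = (v.map x).prod := by
  -- Since `p₀` lies in every `C a`, the sum at `p₀` counts the factors.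
  have hcard : ∀ u : Multiset L, (u.map (charVector C)).sum p₀ = u.card := by
    intro u
    rw [multiset_sum_apply]
    simp [charVector, hp₀]
  induction hn : u.card generalizing u v with
  | zero =>
    have hv0 : v.card = 0 := by
      have := congrFun h p₀
      rw [hcard, hcard, hn] at this
      exact_mod_cast this.symm
    rw [Multiset.card_eq_zero.1 hn, Multiset.card_eq_zero.1 hv0]
  | succ N ih =>
    have hv0 : v.card = N + 1 := by
      have := congrFun h p₀
      rw [hcard, hcard, hn] at this
      exact_mod_cast this.symm
    obtain ⟨a, ha⟩ := Multiset.card_pos_iff_exists_mem.1 (by omega : 0 < u.card)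
    obtain ⟨u, rfl⟩ := Multiset.exists_cons_of_mem ha
    obtain ⟨b, hb⟩ := Multiset.card_pos_iff_exists_mem.1 (by omega : 0 < v.card)
    obtain ⟨v, rfl⟩ := Multiset.exists_cons_of_mem hb
    obtain ⟨t, -, u', hu', hcu, hpu, hsu, htu⟩ := exists_split_sup hsup hinf hM hx u a hu
    obtain ⟨s, -, v', hv', -, hpv, hsv, htv⟩ := exists_split_sup hsup hinf hM hx v b hv
    -- Both joins have the support of the common vector sum as their set, so they coincide and can
    -- be cancelled.
    obtain rfl : t = s := hinj (Set.ext fun p => by rw [htu, htv, h])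
    rw [hpu, hpv, ih u' v' hu' hv' (add_left_cancel (hsu.symm.trans (h.trans hsv)))
      (by simpa [hcu] using hn)]

end Straightening

/-! ### Lattice elements as lower sets of the triangular poset. -/

namespace FlagLattice

variable {n : ℕ}

/-- The extension of `flagIdeal` to `GTBar n`, by the same formula. -/
def cells (a : FlagLattice n) : Set (GTBar n) :=
  {p | (∃ j : Fin (a.1.1 + 1), p.1.2.1 + j.1 + 1 = n ∧ p.1.1.1 + j.1 < (a.2 j).1) ∨
    p.1.2.1 + (a.1.1 + 1) < n}

/-- In the row `s = n - 1 - j` the cells are those with `r < i_j - j`, and the whole row is filled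
when `j` exceeds the last index. Merging the two cases makes joins and meets entrywise. -/
theorem mem_cells_iff {a : FlagLattice n} {p : GTBar n} : p ∈ cells a ↔
    ∀ h : n - 1 - p.1.2.1 < a.1.1 + 1,
      p.1.1.1 + (n - 1 - p.1.2.1) < (a.2 ⟨n - 1 - p.1.2.1, h⟩).1 := by
  have hs := p.1.2.2
  constructor
  · rintro (⟨j, hj, hlt⟩ | hlt) h
    · obtain rfl : j = ⟨n - 1 - p.1.2.1, h⟩ := Fin.ext (by simp only; omega)
      exact hlt
    · omega
  · intro H
    by_cases h : n - 1 - p.1.2.1 < a.1.1 + 1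
    · exact Or.inl ⟨⟨_, h⟩, by simp only; omega, H h⟩
    · exact Or.inr (by omega)

theorem cells_sup (a b : FlagLattice n) : cells (a ⊔ b) = cells a ∪ cells b := by
  ext p
  rw [Set.mem_union, mem_cells_iff, mem_cells_iff, mem_cells_iff]
  generalize n - 1 - p.1.2.1 = j
  have hlen : (a ⊔ b).1.1 = min a.1.1 b.1.1 := by
    change (min a.1 b.1 : Fin (n - 1)).1 = _
    rcases le_total a.1 b.1 with h | h
    · rw [min_eq_left h, min_eq_left (show a.1.1 ≤ b.1.1 from h)]
    · rw [min_eq_right h, min_eq_right (show b.1.1 ≤ a.1.1 from h)]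
  by_cases ha : j < a.1.1 + 1
  · by_cases hb : j < b.1.1 + 1
    · have hab : j < (a ⊔ b).1.1 + 1 := by omega
      have key : ((a ⊔ b).2 ⟨j, hab⟩ : Fin n) = max (a.2 ⟨j, ha⟩) (b.2 ⟨j, hb⟩) := rfl
      have key' : (max (a.2 ⟨j, ha⟩) (b.2 ⟨j, hb⟩)).1 = max (a.2 ⟨j, ha⟩).1 (b.2 ⟨j, hb⟩).1 :=
        Fin.val_strictMono.monotone.map_max
      simp only [ha, hb, hab, forall_true_left, key, key', lt_max_iff]
    · have hab : ¬ j < (a ⊔ b).1.1 + 1 := by omega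
      simp only [hb, hab, IsEmpty.forall_iff, or_true]
  · have hab : ¬ j < (a ⊔ b).1.1 + 1 := by omega
    simp only [ha, hab, IsEmpty.forall_iff, true_or]

theorem cells_inf (a b : FlagLattice n) : cells (a ⊓ b) = cells a ∩ cells b := by
  ext p
  rw [Set.mem_inter_iff, mem_cells_iff, mem_cells_iff, mem_cells_iff]
  generalize n - 1 - p.1.2.1 = j
  have hlen : (a ⊓ b).1.1 = max a.1.1 b.1.1 := by
    change (max a.1 b.1 : Fin (n - 1)).1 = _
    rcases le_total a.1 b.1 with h | h
    · rw [max_eq_right h, max_eq_right (show a.1.1 ≤ b.1.1 from h)]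
    · rw [max_eq_left h, max_eq_left (show b.1.1 ≤ a.1.1 from h)]
  have key : ∀ h : j < (a ⊓ b).1.1 + 1, (a ⊓ b).2 ⟨j, h⟩ = meetSeq a b ⟨j, h⟩ := fun _ => rfl
  by_cases ha : j < a.1.1 + 1
  · have hab : j < (a ⊓ b).1.1 + 1 := by omega
    by_cases hb : j < b.1.1 + 1
    · have key' : (min (a.2 ⟨j, ha⟩) (b.2 ⟨j, hb⟩)).1 = min (a.2 ⟨j, ha⟩).1 (b.2 ⟨j, hb⟩).1 :=
        Fin.val_strictMono.monotone.map_min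
      simp only [ha, hb, hab, forall_true_left, key, meetSeq, dif_pos, key', lt_min_iff]
    · simp only [ha, hb, hab, forall_true_left, key, meetSeq, dif_pos, dif_neg,
        not_false_eq_true, IsEmpty.forall_iff, and_true]
  · by_cases hb : j < b.1.1 + 1
    · have hab : j < (a ⊓ b).1.1 + 1 := by omega
      simp only [ha, hb, hab, forall_true_left, key, meetSeq, dif_neg,
        not_false_eq_true, IsEmpty.forall_iff, true_and]
    · have hab : ¬ j < (a ⊓ b).1.1 + 1 := by omega
      simp only [ha, hb, hab, IsEmpty.forall_iff, and_true]

/-- On the diagonal `r + j = n - 1`, which no entry exceeds, so diagonal cells record only the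
length of the sequence. -/
theorem diag_mem_cells_iff {a : FlagLattice n} {p : GTBar n} (hp : p.1.1 = p.1.2) :
    p ∈ cells a ↔ p.1.1.1 + (a.1.1 + 1) < n := by
  rw [mem_cells_iff]
  have h1 : p.1.1.1 = p.1.2.1 := congrArg Fin.val hp
  have hs := p.1.2.2
  constructor
  · intro H
    by_contra hlt
    have := H (by omega)
    have h2 := (a.2 ⟨n - 1 - p.1.2.1, by omega⟩).2
    omega
  · intro H h
    omega

theorem le_entry {m : ℕ} (f : Fin m ↪o Fin n) (j : ℕ) (hj : j < m) : j ≤ (f ⟨j, hj⟩).1 := by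
  induction j with
  | zero => exact Nat.zero_le _
  | succ j ih =>
    have h : f ⟨j, by omega⟩ < f ⟨j + 1, hj⟩ := f.strictMono (Fin.mk_lt_mk.2 (Nat.lt_succ_self j))
    have h' : (f ⟨j, by omega⟩).1 < (f ⟨j + 1, hj⟩).1 := h
    have := ih (by omega)
    omega

/-- A diagonal cell detects a wrong length, and the cell with `r = b_j - j` in row `n - 1 - j`
detects `b_j < a_j`. -/
theorem le_of_cells_subset {a b : FlagLattice n} (h : cells a ⊆ cells b) : a ≤ b := by
  have hlen : b.1.1 ≤ a.1.1 := by
    by_contra hlt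
    have hb := b.1.2
    have hmem := h ((diag_mem_cells_iff (a := a)
      (p := ⟨(⟨n - 1 - (a.1.1 + 1), by omega⟩, ⟨n - 1 - (a.1.1 + 1), by omega⟩), le_rfl⟩) rfl).2
        (by simp only; omega))
    rw [diag_mem_cells_iff rfl] at hmem
    simp only at hmem
    omega
  refine ⟨hlen, fun j => ?_⟩
  by_contra hlt
  have hlt' : (b.2 j).1 < (a.2 (Fin.castLE (Nat.succ_le_succ hlen) j)).1 := not_le.1 hlt
  have h1 := le_entry b.2 j.1 j.2
  have hb := (b.2 j).2
  have hj := j.2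
  have hb1 := b.1.2
  have ha := (a.2 (Fin.castLE (Nat.succ_le_succ hlen) j)).2
  have hk := b.2.strictMono
  have hbound : (b.2 j).1 - j.1 ≤ n - 1 - j.1 := by omega
  have hp := @h ⟨(⟨(b.2 j).1 - j.1, by omega⟩, ⟨n - 1 - j.1, by omega⟩), hbound⟩
    (Or.inl ⟨Fin.castLE (Nat.succ_le_succ hlen) j, by simp only [Fin.val_castLE]; omega, by
      simp only [Fin.val_castLE]
      simp only [Fin.eta] at h1
      omega⟩)
  rw [mem_cells_iff] at hp
  have hjj : n - 1 - (n - 1 - j.1) = j.1 := by omega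
  simp only [hjj, j.2, forall_true_left, Fin.eta] at hp h1
  omega

theorem cells_injective : Function.Injective (cells : FlagLattice n → Set (GTBar n)) :=
  fun _ _ h => le_antisymm (le_of_cells_subset h.subset) (le_of_cells_subset h.superset)

/-- The entries increase strictly, so `i_j - j` is nondecreasing: rows with smaller `s` are at least
as long. -/
theorem isLowerSet_cells (a : FlagLattice n) : IsLowerSet (cells a) := by
  intro q p hpq hq
  rw [mem_cells_iff] at hq ⊢
  intro h
  have h1 : p.1.1.1 ≤ q.1.1.1 := hpq.1
  have h2 : p.1.2.1 ≤ q.1.2.1 := hpq.2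
  have hqn := q.1.2.2
  have hlt := hq (by omega)
  have key : ∀ (i j : ℕ) (hi : i < a.1.1 + 1) (hj : j < a.1.1 + 1), i ≤ j →
      (a.2 ⟨i, hi⟩).1 + (j - i) ≤ (a.2 ⟨j, hj⟩).1 := by
    intro i j hi hj hij
    induction j, hij using Nat.le_induction with
    | base => simp
    | succ j hij ih =>
      have h : a.2 ⟨j, by omega⟩ < a.2 ⟨j + 1, hj⟩ :=
        a.2.strictMono (Fin.mk_lt_mk.2 (Nat.lt_succ_self j))
      have h' : (a.2 ⟨j, by omega⟩).1 < (a.2 ⟨j + 1, hj⟩).1 := h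
      have := ih (by omega)
      omega
  have := key (n - 1 - q.1.2.1) (n - 1 - p.1.2.1) (by omega) h (by omega)
  omega

/-- Every lower set with the appropriate diagonal elements comes from an element of the lattice. -/
theorem exists_cells_eq {J : Set (GTBar n)} (hJ : IsLowerSet J) (k : Fin (n - 1))
    (hdiag : ∀ p : GTBar n, p.1.1 = p.1.2 → (p ∈ J ↔ p.1.1.1 + (k.1 + 1) < n)) :
    ∃ a : FlagLattice n, a.1 = k ∧ cells a = J := by
  let T : ℕ → ℕ → Prop := fun r s => ∃ (h : r ≤ s) (hs : s < n),
    (⟨(⟨r, h.trans_lt hs⟩, ⟨s, hs⟩), h⟩ : GTBar n) ∈ J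
  have hT : ∀ {r s r' s'}, r ≤ r' → s ≤ s' → r ≤ s → T r' s' → T r s := by
    rintro r s r' s' hr hs hrs ⟨h, hn, hm⟩
    exact ⟨hrs, hs.trans_lt hn, hJ (show (_ : GTBar n) ≤ _ from ⟨hr, hs⟩) hm⟩
  have hTdiag : ∀ s, n ≤ s + (k.1 + 1) → ¬ T s s := by
    rintro s hs ⟨h, hn, hm⟩
    have := (hdiag _ rfl).1 hm
    simp only at this
    omega
  -- `g j` is the length of row `n - 1 - j`, and the entry sought is `g j + j`. For `j ≤ k` the
  -- diagonal condition makes the set nonempty, so the default value of `sInf` plays no role.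
  let g : ℕ → ℕ := fun j => sInf {r | ¬ T r (n - 1 - j)}
  have hgle : ∀ j ≤ k.1, g j ≤ n - 1 - j := fun j hj => Nat.sInf_le (hTdiag _ (by omega))
  have hgnot : ∀ j ≤ k.1, ¬ T (g j) (n - 1 - j) := fun j hj =>
    Nat.sInf_mem (s := {r | ¬ T r (n - 1 - j)}) ⟨_, hTdiag _ (by omega)⟩
  have hglt : ∀ j ≤ k.1, ∀ r, r < g j ↔ T r (n - 1 - j) := by
    intro j hj r
    constructor
    · intro h
      by_contra hr
      exact absurd (Nat.sInf_le (s := {r | ¬ T r (n - 1 - j)}) hr) (not_le.2 h)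
    · intro h
      by_contra hr
      exact hgnot j hj (hT (not_lt.1 hr) le_rfl (hgle j hj) h)
  have hk := k.2
  have hmono : StrictMono (fun j : Fin (k.1 + 1) =>
      (⟨g j.1 + j.1, by have := hgle j.1 (by omega); omega⟩ : Fin n)) := by
    intro i j hij
    have hij' : i.1 < j.1 := hij
    have hj := j.2
    have h1 : g i.1 ≤ g j.1 := by
      by_contra h
      have h2 := (hglt i.1 (by omega) (g j.1)).1 (not_le.1 h)
      exact hgnot j.1 (by omega) (hT le_rfl (by omega) (hgle j.1 (by omega)) h2)
    exact Fin.mk_lt_mk.2 (by omega)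
  refine ⟨⟨k, OrderEmbedding.ofStrictMono _ hmono⟩, rfl, Set.ext fun p => ?_⟩
  have hp := p.1.2.2
  have hple : p.1.1.1 ≤ p.1.2.1 := p.2
  have hTp : T p.1.1.1 p.1.2.1 ↔ p ∈ J := ⟨fun ⟨_, _, h⟩ => h, fun h => ⟨p.2, hp, h⟩⟩
  refine mem_cells_iff.trans ?_
  change (∀ h : n - 1 - p.1.2.1 < k.1 + 1,
    p.1.1.1 + (n - 1 - p.1.2.1) < g (n - 1 - p.1.2.1) + (n - 1 - p.1.2.1)) ↔ _
  by_cases h : n - 1 - p.1.2.1 < k.1 + 1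
  · simp only [h, forall_true_left]
    rw [add_lt_add_iff_right, hglt _ (by omega),
      show n - 1 - (n - 1 - p.1.2.1) = p.1.2.1 by omega, hTp]
  · simp only [h, IsEmpty.forall_iff, true_iff]
    have := (hdiag ⟨(p.1.2, p.1.2), le_rfl⟩ rfl).2 (by simp only; omega)
    exact hJ (show p ≤ ⟨(p.1.2, p.1.2), le_rfl⟩ from ⟨hple, le_rfl⟩) this

end FlagLattice

/-! ### The order extended by a least and a greatest element. -/

section ExtendOrder

variable {n : ℕ} {lt : GTPoset n → GTPoset n → Prop}

theorem extendOrder_of_lt (h : ∀ p q : GTPoset n, p < q → lt p q) {p q : GTBar n} (hpq : p < q) :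
    extendOrder lt p q := by
  have h1 : p.1.1.1 ≤ q.1.1.1 := hpq.le.1
  have h2 : p.1.2.1 ≤ q.1.2.1 := hpq.le.2
  have hq1 : q.1.1.1 ≤ q.1.2.1 := q.2
  have hp1 : p.1.1.1 ≤ p.1.2.1 := p.2
  have hqn := q.1.2.2
  have ext : ∀ a b : GTBar n, a.1.1.1 = b.1.1.1 → a.1.2.1 = b.1.2.1 → a = b := fun a b h h' =>
    Subtype.ext (Prod.ext (Fin.ext h) (Fin.ext h'))
  by_cases hp : p.1.1.1 = 0 ∧ p.1.2.1 = 0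
  · exact Or.inr (Or.inl ⟨hpq.ne, hp⟩)
  by_cases hq : q.1.1.1 + 1 = n ∧ q.1.2.1 + 1 = n
  · exact Or.inr (Or.inr ⟨hpq.ne, hq⟩)
  refine Or.inl ⟨⟨hp, fun hp' => hpq.ne (ext _ _ ?_ ?_)⟩, ⟨fun hq' => hp ?_, hq⟩, h _ _ hpq⟩ <;>
    omega

theorem not_extendOrder_bot (hn : 2 ≤ n) {p q : GTBar n} (hq : q.1.1.1 = 0 ∧ q.1.2.1 = 0) :
    ¬ extendOrder lt p q := by
  rintro (⟨-, h, -⟩ | ⟨hne, hp⟩ | ⟨-, h⟩)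
  · exact h.1 hq
  · exact hne (Subtype.ext (Prod.ext (Fin.ext (hp.1.trans hq.1.symm))
      (Fin.ext (hp.2.trans hq.2.symm))))
  · omega

theorem not_extendOrder_top (hn : 2 ≤ n) {p q : GTBar n}
    (hp : p.1.1.1 + 1 = n ∧ p.1.2.1 + 1 = n) : ¬ extendOrder lt p q := by
  rintro (⟨h, -⟩ | ⟨-, h⟩ | ⟨hne, hq⟩)
  · exact h.2 hp
  · omega
  · exact hne (Subtype.ext (Prod.ext (Fin.ext (by omega)) (Fin.ext (by omega))))

theorem extendOrder_irrefl [IsStrictOrder (GTPoset n) lt] (p : GTBar n) : ¬ extendOrder lt p p := by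
  rintro (⟨hp, _, h⟩ | ⟨h, -⟩ | ⟨h, -⟩)
  · exact irrefl_of lt ⟨p, hp⟩ h
  · exact h rfl
  · exact h rfl

theorem extendOrder_trans [IsStrictOrder (GTPoset n) lt] (hn : 2 ≤ n) {p q r : GTBar n}
    (h₁ : extendOrder lt p q) (h₂ : extendOrder lt q r) : extendOrder lt p r := by
  rcases h₁ with ⟨hp, hq, h₁'⟩ | ⟨-, hp⟩ | ⟨-, hq⟩
  · rcases h₂ with ⟨hq', hr, h₂'⟩ | ⟨-, hq'⟩ | ⟨-, hr⟩
    · exact Or.inl ⟨hp, hr, trans_of lt h₁' h₂'⟩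
    · exact absurd hq' hq.1
    · exact Or.inr (Or.inr ⟨fun h => hp.2 (h ▸ hr), hr⟩)
  · exact Or.inr (Or.inl ⟨fun h => not_extendOrder_bot hn (h ▸ hp) h₂, hp⟩)
  · exact absurd h₂ (not_extendOrder_top hn hq)

/-- The least element lies in every set of cells and the greatest in none, so the extended order
imposes no further condition. -/
theorem cells_of_extendOrder {a : FlagLattice n} (ha : a ∈ idealSublattice lt) {p q : GTBar n}
    (h : extendOrder lt p q) (hq : q ∈ a.cells) : p ∈ a.cells := by
  have hlen := a.1.2
  rcases h with ⟨hp, hq', h⟩ | ⟨-, hp⟩ | ⟨-, hq'⟩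
  · exact ha ⟨p, hp⟩ ⟨q, hq'⟩ h hq
  · exact (FlagLattice.diag_mem_cells_iff (Fin.ext (hp.1.trans hp.2.symm))).2 (by omega)
  · have := (FlagLattice.diag_mem_cells_iff (a := a) (Fin.ext (by omega : q.1.1.1 = q.1.2.1))).1 hq
    omega

theorem mem_idealSublattice_of_cells {a : FlagLattice n}
    (h : ∀ p q, extendOrder lt p q → q ∈ a.cells → p ∈ a.cells) : a ∈ idealSublattice lt :=
  fun p q hpq hq => h p.1 q.1 (Or.inl ⟨p.2, q.2, hpq⟩) hq

theorem idealSublattice_sup_inf {a b : FlagLattice n} (ha : a ∈ idealSublattice lt)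
    (hb : b ∈ idealSublattice lt) : a ⊔ b ∈ idealSublattice lt ∧ a ⊓ b ∈ idealSublattice lt := by
  refine ⟨mem_idealSublattice_of_cells fun p q hpq hq => ?_,
    mem_idealSublattice_of_cells fun p q hpq hq => ?_⟩
  · rw [FlagLattice.cells_sup] at hq ⊢
    exact hq.imp (cells_of_extendOrder ha hpq) (cells_of_extendOrder hb hpq)
  · rw [FlagLattice.cells_inf] at hq ⊢
    exact ⟨cells_of_extendOrder ha hpq hq.1, cells_of_extendOrder hb hpq hq.2⟩

end ExtendOrder

/-! ### Integer points as sums of order ideal vectors. -/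

section LatticePoints

variable {n : ℕ}

/-- The integer points of the `c (n - 1)`-fold dilation of the marked order polytope. -/
def integralPatterns (lt : GTPoset n → GTPoset n → Prop) (c : ℕ) : Set (GTBar n → ℤ) :=
  {y | (∀ p : GTBar n, p.1.1 = p.1.2 → y p = c * ((n : ℤ) - 1 - p.1.1.1)) ∧
    ∀ p q, extendOrder lt p q → y q ≤ y p}

variable {lt : GTPoset n → GTPoset n → Prop}

/-- The factor `n - 1` clears the denominator of the marking. -/
theorem mem_smul_markedOrderPolytope_iff (hn : 2 ≤ n) {c : ℝ} (hc : 0 < c) (x : GTBar n → ℝ) :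
    x ∈ (c * (n - 1) : ℝ) • markedOrderPolytope (extendOrder lt) (gtMarked n) (gtMarking n) ↔
      (∀ p : GTBar n, p.1.1 = p.1.2 → x p = c * ((n : ℝ) - 1 - p.1.1.1)) ∧
        ∀ p q, extendOrder lt p q → x q ≤ x p := by
  have hn1 : (0 : ℝ) < n - 1 := by
    have : (2 : ℝ) ≤ n := by exact_mod_cast hn
    linarith
  have hK : 0 < c * ((n : ℝ) - 1) := mul_pos hc hn1
  rw [Set.mem_smul_set_iff_inv_smul_mem₀ hK.ne']
  refine and_congr ?_ (forall₃_congr fun p q _ => ?_)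
  · rw [Subtype.forall]
    refine forall₂_congr fun p hp => ?_
    rw [Pi.smul_apply, smul_eq_mul, inv_mul_eq_iff_eq_mul₀ hK.ne', gtMarking, mul_assoc,
      mul_div_cancel₀ _ hn1.ne']
    ring_nf
  · rw [Pi.smul_apply, Pi.smul_apply, smul_eq_mul, smul_eq_mul,
      mul_le_mul_iff_right₀ (inv_pos.2 hK)]

theorem latticePoints_smul (hn : 2 ≤ n) {c : ℕ} (hc : 0 < c) :
    latticePoints ((c * (n - 1) : ℝ) •
      markedOrderPolytope (extendOrder lt) (gtMarked n) (gtMarking n)) =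
        integralPatterns lt c := by
  ext y
  refine (mem_smul_markedOrderPolytope_iff hn (Nat.cast_pos.2 hc) _).trans
    (and_congr (forall₂_congr fun p _ => ?_) (forall₃_congr fun p q _ => Int.cast_le))
  rw [← @Int.cast_inj ℝ]
  push_cast
  rfl

/-- The number of `k < n - 1` with `r + k + 1 < n`. -/
theorem sum_ite_add_lt (n r : ℕ) (hr : r < n) :
    (∑ k : Fin (n - 1), if r + (k.1 + 1) < n then (1 : ℤ) else 0) = (n : ℤ) - 1 - r := by
  rw [Fin.sum_univ_eq_sum_range (fun k => if r + (k + 1) < n then (1 : ℤ) else 0),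
    ← Finset.sum_filter, Finset.sum_const]
  have : (Finset.range (n - 1)).filter (fun k => r + (k + 1) < n) = Finset.range (n - 1 - r) := by
    ext k
    simp only [Finset.mem_filter, Finset.mem_range]
    omega
  rw [this, Finset.card_range]
  simp only [nsmul_eq_mul, mul_one]
  omega

theorem sum_ite_lt (N : ℕ) (y : ℤ) (h0 : 0 ≤ y) (h1 : y ≤ N) :
    (∑ t : Fin N, if (t.1 : ℤ) + 1 ≤ y then (1 : ℤ) else 0) = y := by
  lift y to ℕ using h0
  rw [Fin.sum_univ_eq_sum_range (fun t : ℕ => if (t : ℤ) + 1 ≤ y then (1 : ℤ) else 0),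
    ← Finset.sum_filter, Finset.sum_const]
  have : (Finset.range N).filter (fun t : ℕ => (t : ℤ) + 1 ≤ y) = Finset.range y := by
    ext k
    simp only [Finset.mem_filter, Finset.mem_range]
    omega
  rw [this, Finset.card_range]
  simp

/-- The vector associated with an element of the lattice. -/
abbrev flagVector (a : FlagLattice n) : GTBar n → ℤ := charVector FlagLattice.cells a

theorem flagVector_eq_ite (a : FlagLattice n) (p : GTBar n) [Decidable (p ∈ a.cells)] :
    flagVector a p = if p ∈ a.cells then 1 else 0 := by
  simp [flagVector, charVector, Set.indicator_apply]

/-- The index of the factor `∧^{k+1} ℂ^n` to which an element of the lattice belongs. -/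
def FlagLattice.degree (a : FlagLattice n) : Fin (n - 1) := a.1

/-- An integer point is the sum of the vectors of its level sets. -/
theorem exists_eq_sum_flagVector (hn : 2 ≤ n) (hlt : ∀ p q : GTPoset n, p < q → lt p q) {c : ℕ}
    {y : GTBar n → ℤ} (hy : y ∈ integralPatterns lt c) :
    ∃ a : Fin (n - 1) → Fin c → FlagLattice n, (∀ k j, (a k j).degree = k) ∧
      (∀ k j, a k j ∈ idealSublattice lt) ∧ y = ∑ j, ∑ k, flagVector (a k j) := by
  classical
  have hlower : ∀ t : ℤ, IsLowerSet {p : GTBar n | t ≤ y p} := by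
    intro t q p hpq hq
    rcases hpq.eq_or_lt with rfl | hpq
    · exact hq
    · exact le_trans hq (hy.2 p q (extendOrder_of_lt hlt hpq))
  -- Diagonal values are multiples of `c`. Because `0 ≤ j < c`, such a value reaches the threshold
  -- `ck + j + 1` exactly when it is at least `c(k + 1)`, so this superlevel set has degree `k`.
  have hdiag : ∀ (k : Fin (n - 1)) (j : Fin c) (p : GTBar n), p.1.1 = p.1.2 →
      (p ∈ {p : GTBar n | (c * k.1 + j.1 : ℤ) + 1 ≤ y p} ↔ p.1.1.1 + (k.1 + 1) < n) := by
    intro k j p hp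
    rw [Set.mem_ofPred_eq, hy.1 p hp]
    have hj := j.2
    have hr := p.1.1.2
    constructor
    · intro h
      by_contra hcon
      have : (n : ℤ) - 1 - p.1.1.1 ≤ k.1 := by omega
      have := mul_le_mul_of_nonneg_left this (Int.natCast_nonneg c)
      omega
    · intro h
      have : (k.1 : ℤ) + 1 ≤ (n : ℤ) - 1 - p.1.1.1 := by omega
      have := mul_le_mul_of_nonneg_left this (Int.natCast_nonneg c)
      rw [mul_add, mul_one] at this
      omega
  choose a ha hcells using fun k j => FlagLattice.exists_cells_eq
    (hlower ((c * (k : Fin (n - 1)).1 + (j : Fin c).1 : ℤ) + 1)) k (hdiag k j)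
  refine ⟨a, ha, fun k j => mem_idealSublattice_of_cells fun p q hpq hq => ?_, ?_⟩
  · rw [hcells] at hq ⊢
    exact le_trans hq (hy.2 p q hpq)
  · funext p
    have h0 : 0 < n := by omega
    -- The least and greatest elements bound all values, so `y p` is the number of thresholds `1, …,
    -- (n - 1)c` that it reaches; these are indexed by the pairs `(k, j)`.
    have hbot : y p ≤ ((n - 1) * c : ℕ) := by
      have hb := hy.1 ⟨(⟨0, h0⟩, ⟨0, h0⟩), le_rfl⟩ rfl
      have : ((c : ℤ) * ((n : ℤ) - 1 - (0 : ℕ))) = ((n - 1) * c : ℕ) := by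
        push_cast [Nat.cast_sub (by omega : 1 ≤ n)]
        ring
      rw [← this, ← hb]
      by_cases hp : (⟨(⟨0, h0⟩, ⟨0, h0⟩), le_rfl⟩ : GTBar n) = p
      · rw [hp]
      · exact hy.2 _ _ (Or.inr (Or.inl ⟨hp, rfl, rfl⟩))
    have htop : 0 ≤ y p := by
      have hb := hy.1 ⟨(⟨n - 1, by omega⟩, ⟨n - 1, by omega⟩), le_rfl⟩ rfl
      have : ((c : ℤ) * ((n : ℤ) - 1 - (n - 1 : ℕ))) = 0 := by
        push_cast [Nat.cast_sub (by omega : 1 ≤ n)]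
        ring
      rw [← this, ← hb]
      by_cases hp : p = ⟨(⟨n - 1, by omega⟩, ⟨n - 1, by omega⟩), le_rfl⟩
      · rw [← hp]
      · exact hy.2 _ _ (Or.inr (Or.inr ⟨hp, Nat.sub_add_cancel h0, Nat.sub_add_cancel h0⟩))
    rw [Finset.sum_comm, ← Fintype.sum_prod_type', Finset.sum_apply,
      ← sum_ite_lt _ (y p) htop hbot, ← finProdFinEquiv.sum_comp]
    refine Finset.sum_congr rfl fun kj _ => ?_
    rw [flagVector_eq_ite]
    refine if_congr ?_ rfl rfl
    rw [hcells, Set.mem_ofPred_eq, finProdFinEquiv_apply_val]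
    push_cast
    rw [add_comm (c * (kj.1.1 : ℤ))]

/-- Diagonal values depend only on the degrees, hence on `D`; the inequalities hold for each summand
separately. -/
theorem sum_flagVector_mem {c : ℕ} {u : Multiset (FlagLattice n)}
    (hu : ∀ a ∈ u, a ∈ idealSublattice lt)
    (hD : u.map FlagLattice.degree = c • (Finset.univ : Finset (Fin (n - 1))).val) :
    (u.map flagVector).sum ∈ integralPatterns lt c := by
  classical
  refine ⟨fun p hp => ?_, fun p q hpq => ?_⟩
  · rw [multiset_sum_apply]
    have : u.map (fun a => flagVector a p) =
        (u.map FlagLattice.degree).map fun k => if p.1.1.1 + (k.1 + 1) < n then (1 : ℤ) else 0 := by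
      rw [Multiset.map_map]
      refine Multiset.map_congr rfl fun a _ => ?_
      rw [flagVector_eq_ite]
      exact if_congr (FlagLattice.diag_mem_cells_iff hp) rfl rfl
    rw [this, hD, Multiset.map_nsmul, Multiset.sum_nsmul, nsmul_eq_mul]
    congr 1
    exact sum_ite_add_lt n _ p.1.1.2
  · rw [multiset_sum_apply, multiset_sum_apply]
    refine Multiset.sum_map_le_sum_map _ _ fun a ha => ?_
    rw [flagVector_eq_ite, flagVector_eq_ite]
    by_cases hq : q ∈ a.cells
    · rw [if_pos hq, if_pos (cells_of_extendOrder (hu a ha) hpq hq)]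
    · rw [if_neg hq]
      split_ifs <;> simp

theorem multiset_map_sum {α β T : Type} [Fintype T] (f : α → β) (u : T → Multiset α) :
    (∑ j, u j).map f = ∑ j, (u j).map f :=
  map_sum (Multiset.mapAddMonoidHom f) u Finset.univ

theorem mem_integralPatterns_iff (hn : 2 ≤ n) (hlt : ∀ p q : GTPoset n, p < q → lt p q) {c : ℕ}
    {y : GTBar n → ℤ} : y ∈ integralPatterns lt c ↔ ∃ u : Multiset (FlagLattice n),
      (∀ a ∈ u, a ∈ idealSublattice lt) ∧
      u.map FlagLattice.degree = c • (Finset.univ : Finset (Fin (n - 1))).val ∧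
      (u.map flagVector).sum = y := by
  constructor
  · intro hy
    obtain ⟨a, ha, haM, rfl⟩ := exists_eq_sum_flagVector hn hlt hy
    refine ⟨∑ j, (Finset.univ : Finset (Fin (n - 1))).val.map fun k => a k j, ?_, ?_, ?_⟩
    · intro s hs
      obtain ⟨j, -, hs⟩ := Multiset.mem_sum.1 hs
      obtain ⟨k, -, rfl⟩ := Multiset.mem_map.1 hs
      exact haM k j
    · simp only [multiset_map_sum, Multiset.map_map, Function.comp_def, ha, Multiset.map_id',
        Finset.sum_const, Finset.card_univ, Fintype.card_fin]
    · rw [multiset_map_sum, Multiset.sum_sum]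
      simp only [Multiset.map_map]
      rfl
  · rintro ⟨u, hu, hD, rfl⟩
    exact sum_flagVector_mem hu hD

theorem integralPatterns_eq (hn : 2 ≤ n) (hlt : ∀ p q : GTPoset n, p < q → lt p q) (c : ℕ) :
    integralPatterns lt c = MultiProj.degreeSums (ι := PluckerIndex n) flagVector
      (idealSublattice lt) (c • (Finset.univ : Finset (Fin (n - 1))).val) :=
  Set.ext fun _ => mem_integralPatterns_iff hn hlt

/-- For fixed `j` the layers `a k j` contain one element of each degree, so their sum is a pattern
with `c = 1`. This is the normality of the polytope. -/
theorem exists_sum_integralPatterns (hn : 2 ≤ n) (hlt : ∀ p q : GTPoset n, p < q → lt p q) {c : ℕ}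
    {y : GTBar n → ℤ} (hy : y ∈ integralPatterns lt c) :
    ∃ z : Fin c → GTBar n → ℤ, (∀ j, z j ∈ integralPatterns lt 1) ∧ y = ∑ j, z j := by
  obtain ⟨a, ha, haM, hsum⟩ := exists_eq_sum_flagVector hn hlt hy
  refine ⟨fun j => ∑ k, flagVector (a k j), fun j => ?_, hsum⟩
  have := sum_flagVector_mem (lt := lt) (c := 1)
    (u := (Finset.univ : Finset (Fin (n - 1))).val.map fun k => a k j) (by
      intro s hs
      obtain ⟨k, -, rfl⟩ := Multiset.mem_map.1 hs
      exact haM k j) (by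
      rw [Multiset.map_map, one_smul]
      exact (Multiset.map_congr rfl fun k _ => ha k j).trans (Multiset.map_id' _))
  rwa [Multiset.map_map] at this

end LatticePoints

/-! ### Integrality and normality of the dilated polytope. -/

section Polytope

/-- The mean of `x + θ` is `x + 1/2`, and by periodicity its fractional part has mean `1/2`. -/
theorem intervalIntegral_floor_add (x : ℝ) : ∫ θ in (0 : ℝ)..1, (⌊x + θ⌋ : ℝ) = x := by
  have hfract : ∫ θ in (0 : ℝ)..1, Int.fract (x + θ) = 1 / 2 := by
    rw [intervalIntegral.integral_comp_add_left (fun θ => Int.fract θ) x, add_zero,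
      (Int.fract_periodic ℝ).intervalIntegral_add_eq x 0, zero_add]
    have : ∫ θ in (0 : ℝ)..1, Int.fract θ = ∫ θ in (0 : ℝ)..1, θ := by
      refine intervalIntegral.integral_congr_ae ?_
      have h1 : ∀ᵐ θ : ℝ, θ ≠ 1 := by simp [MeasureTheory.ae_iff]
      filter_upwards [h1] with θ hθ hmem
      rw [Set.uIoc_of_le zero_le_one] at hmem
      exact Int.fract_eq_self.2 ⟨hmem.1.le, lt_of_le_of_ne hmem.2 hθ⟩
    rw [this, integral_id]
    norm_num
  have hmono : Monotone fun θ : ℝ => (⌊x + θ⌋ : ℝ) := fun a b hab =>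
    Int.cast_le.2 (Int.floor_le_floor (by linarith))
  have hint : IntervalIntegrable (fun θ : ℝ => (⌊x + θ⌋ : ℝ)) MeasureTheory.volume 0 1 :=
    hmono.intervalIntegrable
  have hlin : IntervalIntegrable (fun θ : ℝ => x + θ) MeasureTheory.volume 0 1 :=
    (continuous_const.add continuous_id).intervalIntegrable _ _
  have hsub := intervalIntegral.integral_sub hlin hint
  have : ∀ θ : ℝ, x + θ - ⌊x + θ⌋ = Int.fract (x + θ) := fun θ => rfl
  simp only [this, hfract] at hsub
  rw [intervalIntegral.integral_add (by simp) (by simp), integral_id] at hsub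
  simp only [intervalIntegral.integral_const, smul_eq_mul] at hsub
  linarith

/-- If all translates by constants `θ ∈ [0, 1)` of `x`, rounded down, lie in the finite set `S`,
then `x` lies in the convex hull of `S`. -/
theorem mem_convexHull_of_floor {I : Type} [Finite I] {S : Set (I → ℤ)} (hS : S.Finite) {x : I → ℝ}
    (h : ∀ θ : ℝ, 0 ≤ θ → θ < 1 → (fun i => ⌊x i + θ⌋) ∈ S) :
    x ∈ convexHull ℝ ((fun (m : I → ℤ) (i : I) => (m i : ℝ)) '' S) := by
  have := Fintype.ofFinite I
  let μ : MeasureTheory.Measure ℝ := MeasureTheory.volume.restrict (Set.Ioc 0 1)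
  have : MeasureTheory.IsProbabilityMeasure μ := ⟨by simp [μ]⟩
  let f : ℝ → I → ℝ := fun θ i => (⌊x i + θ⌋ : ℝ)
  have hint : ∀ i, MeasureTheory.Integrable (fun θ => f θ i) μ := by
    intro i
    have hmono : Monotone fun θ : ℝ => (⌊x i + θ⌋ : ℝ) := fun a b hab =>
      Int.cast_le.2 (Int.floor_le_floor (by linarith))
    exact (intervalIntegrable_iff_integrableOn_Ioc_of_le zero_le_one).1
      (hmono.intervalIntegrable (μ := MeasureTheory.volume) (a := 0) (b := 1))
  -- `x` is the average of its roundings, and a closed convex set contains the averages of its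
  -- points.
  have hx : x = ∫ θ, f θ ∂μ := by
    funext i
    rw [MeasureTheory.eval_integral hint, ← intervalIntegral.integral_of_le zero_le_one]
    exact (intervalIntegral_floor_add (x i)).symm
  rw [hx]
  refine (convex_convexHull ℝ _).integral_mem ((hS.image _).isCompact_convexHull ℝ).isClosed ?_
    (MeasureTheory.Integrable.of_eval hint)
  have h1 : ∀ᵐ θ : ℝ ∂μ, θ ≠ 1 :=
    MeasureTheory.ae_restrict_of_ae (by simp [MeasureTheory.ae_iff])
  filter_upwards [h1, MeasureTheory.ae_restrict_mem measurableSet_Ioc] with θ hθ hmem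
  exact subset_convexHull ℝ _ ⟨_, h θ hmem.1.le (lt_of_le_of_ne hmem.2 hθ), rfl⟩

variable {n : ℕ} {lt : GTPoset n → GTPoset n → Prop}

/-- The witness counts the marked elements other than the greatest that lie weakly above `p`.
Irreflexivity and transitivity ensure that a marked element sees only those later on the diagonal.
-/
theorem integralPatterns_nonempty [IsStrictOrder (GTPoset n) lt] (hn : 2 ≤ n)
    (hlt : ∀ p q : GTPoset n, p < q → lt p q) : (integralPatterns lt 1).Nonempty := by
  classical
  let d : Fin n → GTBar n := fun r => ⟨(r, r), le_rfl⟩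
  let above : GTBar n → Finset (Fin n) := fun p =>
    Finset.univ.filter fun r => r.1 + 1 < n ∧ (p = d r ∨ extendOrder lt p (d r))
  refine ⟨fun p => ((above p).card : ℤ), fun p hp => ?_, fun p q hpq => ?_⟩
  · obtain ⟨⟨r, s⟩, hrs⟩ := p
    obtain rfl : r = s := hp
    have hlt' : ∀ {a b : Fin n}, a < b → extendOrder lt (d a) (d b) := fun {a b} hab =>
      extendOrder_of_lt hlt (show d a < d b from
        Subtype.mk_lt_mk.2 (Prod.mk_lt_mk_of_lt_of_le hab hab.le))
    have heq : (above ⟨(r, r), hrs⟩) = Finset.univ.filter fun t : Fin n => r ≤ t ∧ t.1 + 1 < n := by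
      ext t
      simp only [above, Finset.mem_filter, Finset.mem_univ, true_and]
      rw [and_comm]
      refine and_congr_left fun _ => ?_
      constructor
      · intro h
        by_contra hcon
        have h1 := hlt' (not_le.1 hcon)
        rcases h with h | h
        · have : r = t := congrArg (fun p : GTBar n => p.1.1) h
          exact hcon this.le
        · exact extendOrder_irrefl _ (extendOrder_trans hn h h1)
      · intro h
        rcases h.eq_or_lt with rfl | h
        · exact Or.inl rfl
        · exact Or.inr (hlt' h)
    have hcard : (Finset.univ.filter fun t : Fin n => r ≤ t ∧ t.1 + 1 < n) =
        Finset.Ico r ⟨n - 1, by omega⟩ := by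
      ext t
      simp only [Finset.mem_filter, Finset.mem_univ, true_and, Finset.mem_Ico, Fin.lt_def]
      omega
    have hr := r.2
    simp only [heq, hcard, Fin.card_Ico]
    omega
  · refine Int.ofNat_le.2 (Finset.card_le_card fun r hr => ?_)
    simp only [above, Finset.mem_filter, Finset.mem_univ, true_and] at hr ⊢
    refine ⟨hr.1, Or.inr ?_⟩
    rcases hr.2 with h | h
    · rwa [← h]
    · exact extendOrder_trans hn hpq h

theorem finite_integralPatterns (hn : 2 ≤ n) (c : ℕ) : (integralPatterns lt c).Finite := by
  have h0 : 0 < n := by omega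
  have hbot : ∀ p : GTBar n, p = ⟨(⟨0, h0⟩, ⟨0, h0⟩), le_rfl⟩ ∨
      extendOrder lt ⟨(⟨0, h0⟩, ⟨0, h0⟩), le_rfl⟩ p := fun p => by
    by_cases hp : p = ⟨(⟨0, h0⟩, ⟨0, h0⟩), le_rfl⟩
    · exact Or.inl hp
    · exact Or.inr (Or.inr (Or.inl ⟨Ne.symm hp, rfl, rfl⟩))
  have htop : ∀ p : GTBar n, p = ⟨(⟨n - 1, by omega⟩, ⟨n - 1, by omega⟩), le_rfl⟩ ∨
      extendOrder lt p ⟨(⟨n - 1, by omega⟩, ⟨n - 1, by omega⟩), le_rfl⟩ := fun p => by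
    by_cases hp : p = ⟨(⟨n - 1, by omega⟩, ⟨n - 1, by omega⟩), le_rfl⟩
    · exact Or.inl hp
    · exact Or.inr (Or.inr (Or.inr ⟨hp, Nat.sub_add_cancel h0, Nat.sub_add_cancel h0⟩))
  refine (Set.finite_Icc
    (fun _ : GTBar n => (c : ℤ) * ((n : ℤ) - 1 - ((⟨n - 1, by omega⟩ : Fin n).1 : ℕ)))
    (fun _ : GTBar n => (c : ℤ) * ((n : ℤ) - 1 - ((⟨0, h0⟩ : Fin n).1 : ℕ)))).subset ?_
  refine fun y hy => ⟨fun p => ?_, fun p => ?_⟩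
  · have := hy.1 ⟨(⟨n - 1, by omega⟩, ⟨n - 1, by omega⟩), le_rfl⟩ rfl
    refine this.symm.le.trans ?_
    rcases htop p with h | h
    · rw [h]
    · exact hy.2 _ _ h
  · have := hy.1 ⟨(⟨0, h0⟩, ⟨0, h0⟩), le_rfl⟩ rfl
    refine le_trans ?_ this.le
    rcases hbot p with h | h
    · rw [h]
    · exact hy.2 _ _ h

theorem convex_markedOrderPolytope {E : Type} (ll : E → E → Prop) (M : Set E) (lam : M → ℝ) :
    Convex ℝ (markedOrderPolytope ll M lam) := by
  intro x hx y hy a b ha hb hab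
  refine ⟨fun p => ?_, fun p q hpq => ?_⟩
  · simp only [Pi.add_apply, Pi.smul_apply, smul_eq_mul, hx.1 p, hy.1 p, ← add_mul, hab, one_mul]
  · simp only [Pi.add_apply, Pi.smul_apply, smul_eq_mul]
    exact add_le_add (mul_le_mul_of_nonneg_left (hx.2 p q hpq) ha)
      (mul_le_mul_of_nonneg_left (hy.2 p q hpq) hb)

theorem isNormalLatticePolytope_smul [IsStrictOrder (GTPoset n) lt] (hn : 2 ≤ n)
    (hlt : ∀ p q : GTPoset n, p < q → lt p q) :
    IsNormalLatticePolytope (((n - 1 : ℕ) : ℝ) •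
      markedOrderPolytope (extendOrder lt) (gtMarked n) (gtMarking n)) := by
  have hcast : ((n - 1 : ℕ) : ℝ) = ((1 : ℕ) : ℝ) * (n - 1) := by
    rw [Nat.cast_sub (by omega)]
    simp
  have hpts : latticePoints (((n - 1 : ℕ) : ℝ) •
      markedOrderPolytope (extendOrder lt) (gtMarked n) (gtMarking n)) =
        integralPatterns lt 1 := by
    rw [hcast, latticePoints_smul hn one_pos]
  refine ⟨⟨(finite_integralPatterns (lt := lt) hn 1).toFinset, ?_, ?_⟩, fun k hk m hm => ?_⟩
  · exact (Set.Finite.toFinset_nonempty _).2 (integralPatterns_nonempty hn hlt)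
  · rw [Set.Finite.coe_toFinset]
    refine Set.Subset.antisymm (fun x hx => ?_) (convexHull_min ?_ ?_)
    -- Rounding `x + θ` down preserves the inequalities, and it fixes the marked values because they
    -- are integers and `0 ≤ θ < 1`.
    · refine mem_convexHull_of_floor (finite_integralPatterns hn 1) fun θ h0 h1 => ?_
      rw [hcast, mem_smul_markedOrderPolytope_iff hn (by simp)] at hx
      refine ⟨fun p hp => ?_, fun p q hpq => Int.floor_le_floor ?_⟩
      · have h2 : x p = (((1 : ℕ) * ((n : ℤ) - 1 - p.1.1.1) : ℤ) : ℝ) := by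
          rw [hx.1 p hp]
          push_cast
          rfl
        change ⌊x p + θ⌋ = _
        rw [h2, Int.floor_intCast_add, Int.floor_eq_zero_iff.2 ⟨h0, h1⟩, add_zero]
      · linarith [hx.2 p q hpq]
    · rintro _ ⟨m, hm, rfl⟩
      rw [← hpts] at hm
      exact hm
    · exact (convex_markedOrderPolytope _ _ _).smul _
  · rw [hcast, smul_smul, Nat.cast_one, one_mul, latticePoints_smul hn hk] at hm
    rw [hpts]
    exact exists_sum_integralPatterns hn hlt hm

/-- The element `p_{n-1,n-1}` is marked by `1/(n-1)`, so any integer point of the dilation has value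
`k/(n-1)` there; this value is `c`. -/
theorem exists_eq_mul_of_isLatticePolytope (hn : 2 ≤ n) {k : ℕ} (hk : 0 < k)
    (h : IsLatticePolytope ((k : ℝ) •
      markedOrderPolytope (extendOrder lt) (gtMarked n) (gtMarking n))) :
    ∃ c : ℕ, 0 < c ∧ (k : ℝ) = c * (n - 1) := by
  obtain ⟨S, ⟨m, hm⟩, hS⟩ := h
  have hmem : (fun i => (m i : ℝ)) ∈ (k : ℝ) •
      markedOrderPolytope (extendOrder lt) (gtMarked n) (gtMarking n) := by
    rw [hS]
    exact subset_convexHull ℝ _ ⟨m, hm, rfl⟩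
  have hk' : (0 : ℝ) < k := Nat.cast_pos.2 hk
  rw [Set.mem_smul_set_iff_inv_smul_mem₀ hk'.ne'] at hmem
  let p : GTBar n := ⟨(⟨n - 2, by omega⟩, ⟨n - 2, by omega⟩), le_rfl⟩
  have hp := hmem.1 ⟨p, rfl⟩
  have hn1 : (0 : ℝ) < n - 1 := by
    have : (2 : ℝ) ≤ n := by exact_mod_cast hn
    linarith
  have hmark : gtMarking n ⟨p, rfl⟩ = 1 / ((n : ℝ) - 1) := by
    have : ((n - 2 : ℕ) : ℝ) = n - 2 := by
      rw [Nat.cast_sub hn]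
      simp
    simp only [gtMarking, p, this]
    congr 1
    ring
  rw [hmark, Pi.smul_apply, smul_eq_mul, inv_mul_eq_iff_eq_mul₀ hk'.ne', mul_one_div,
    eq_div_iff hn1.ne'] at hp
  have hpos : 0 < m p := by
    have : (0 : ℝ) < m p := pos_of_mul_pos_left (hp ▸ hk') hn1.le
    exact_mod_cast this
  refine ⟨(m p).toNat, by omega, ?_⟩
  rw [← hp]
  congr 1
  exact_mod_cast (Int.toNat_of_nonneg hpos.le).symm

end Polytope

/-! ### The subvariety as a binomial locus, and the conclusion. -/

section Variety

variable {n : ℕ} {lt : GTPoset n → GTPoset n → Prop}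

open MultiProj

/-- The homogeneous coordinates of a point, indexed by the elements of the lattice. -/
def pluckerCoord (x : MultiProj (PluckerIndex n)) : FlagLattice n → ℂ := coord x

theorem isMultiHom_flag_prod (u : Multiset (FlagLattice n)) {d : Fin (n - 1) → ℕ}
    (hd : ∀ k, d k = (u.map FlagLattice.degree).count k) :
    IsMultiHom (ι := PluckerIndex n)
      ((u.map MvPolynomial.X).prod : MvPolynomial (FlagLattice n) ℂ) d :=
  isMultiHom_multiset_prod (ι := PluckerIndex n) u hd

theorem map_degree_pair (a b : FlagLattice n) :
    ({a, b} : Multiset (FlagLattice n)).map FlagLattice.degree =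
      ({a ⊔ b, a ⊓ b} : Multiset (FlagLattice n)).map FlagLattice.degree := by
  have h1 : (a ⊔ b).degree = min a.degree b.degree := rfl
  have h2 : (a ⊓ b).degree = max a.degree b.degree := rfl
  simp only [Multiset.insert_eq_cons, Multiset.map_cons, Multiset.map_singleton, h1, h2]
  rcases le_total a.degree b.degree with h | h
  · rw [min_eq_left h, max_eq_right h]
  · rw [min_eq_right h, max_eq_left h]
    exact Multiset.pair_comm _ _

/-- All generators are multihomogeneous: join and meet have the minimum and maximum of the two
degrees. Testing the generators therefore suffices. -/
theorem mem_multVariety_strongerIdeal_iff (x : MultiProj (PluckerIndex n)) :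
    x ∈ multVariety (strongerIdeal lt) ↔ (∀ a ∉ idealSublattice lt, pluckerCoord x a = 0) ∧
      ∀ a ∈ idealSublattice lt, ∀ b ∈ idealSublattice lt,
        pluckerCoord x a * pluckerCoord x b =
          pluckerCoord x (a ⊔ b) * pluckerCoord x (a ⊓ b) := by
  have heval : ∀ F : MvPolynomial (FlagLattice n) ℂ,
      evalAt x F = MvPolynomial.eval (pluckerCoord x) F := fun F => rfl
  constructor
  · intro h
    refine ⟨fun a ha => ?_, fun a ha b hb => ?_⟩
    · have := h (MvPolynomial.X a : MvPolynomial (FlagLattice n) ℂ)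
        (Ideal.subset_span (Or.inr ⟨a, ha, rfl⟩)) _ (isMultiHom_X (ι := PluckerIndex n) a)
      rwa [heval, MvPolynomial.eval_X] at this
    · have h1 := isMultiHom_flag_prod {a, b} fun _ => rfl
      have h2 := isMultiHom_flag_prod {a ⊔ b, a ⊓ b} fun k =>
        congrArg (Multiset.count k) (map_degree_pair a b)
      simp only [Multiset.insert_eq_cons, Multiset.map_cons, Multiset.map_singleton,
        Multiset.prod_cons, Multiset.prod_singleton] at h1 h2
      have := h (MvPolynomial.X a * MvPolynomial.X b -
        MvPolynomial.X (a ⊔ b) * MvPolynomial.X (a ⊓ b) : MvPolynomial (FlagLattice n) ℂ)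
        (Ideal.subset_span (Or.inl ⟨a, ha, b, hb, rfl⟩)) _ (h1.sub h2)
      rw [heval, map_sub, map_mul, map_mul, sub_eq_zero] at this
      simpa only [MvPolynomial.eval_X] using this
  · rintro ⟨h1, h2⟩ F hF d -
    have hle : strongerIdeal lt ≤ RingHom.ker (MvPolynomial.eval (pluckerCoord x)) := by
      refine Ideal.span_le.2 ?_
      rintro _ (⟨a, ha, b, hb, rfl⟩ | ⟨a, ha, rfl⟩)
      · rw [SetLike.mem_coe, RingHom.mem_ker, map_sub, map_mul, map_mul, sub_eq_zero]
        simpa only [MvPolynomial.eval_X] using h2 a ha b hb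
      · rw [SetLike.mem_coe, RingHom.mem_ker, MvPolynomial.eval_X]
        exact h1 a ha
    exact hle hF

theorem mem_binomialLocus_flag_iff (M : Set (FlagLattice n)) (x : MultiProj (PluckerIndex n)) :
    x ∈ binomialLocus (ι := PluckerIndex n) flagVector M ↔ (∀ a ∉ M, pluckerCoord x a = 0) ∧
      ∀ u v : Multiset (FlagLattice n), (∀ a ∈ u, a ∈ M) → (∀ a ∈ v, a ∈ M) →
        u.map FlagLattice.degree = v.map FlagLattice.degree →
        (u.map flagVector).sum = (v.map flagVector).sum →
        (u.map (pluckerCoord x)).prod = (v.map (pluckerCoord x)).prod :=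
  Iff.rfl

/-- Straightening derives every binomial from the Hibi relations; conversely, each Hibi relation is
one of the binomials. -/
theorem multVariety_strongerIdeal_eq (hn : 2 ≤ n) : multVariety (strongerIdeal lt) =
    binomialLocus (ι := PluckerIndex n) flagVector (idealSublattice lt) := by
  ext x
  rw [mem_multVariety_strongerIdeal_iff, mem_binomialLocus_flag_iff]
  refine and_congr_right fun _ => ⟨fun h u v hu hv _ huv => ?_, fun h a ha b hb => ?_⟩
  · have h0 : 0 < n := by omega
    refine prod_eq_of_sum_charVector_eq FlagLattice.cells_sup FlagLattice.cells_inf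
      FlagLattice.cells_injective ⟨(⟨0, h0⟩, ⟨0, h0⟩), le_rfl⟩ (fun a => ?_)
      (fun a ha b hb => idealSublattice_sup_inf ha hb) h u v hu hv huv
    have := a.1.2
    exact (FlagLattice.diag_mem_cells_iff rfl).2 (by simp only; omega)
  · have hM := idealSublattice_sup_inf ha hb
    have := h {a, b} {a ⊔ b, a ⊓ b} (by simp [ha, hb]) (by simp [hM]) (map_degree_pair a b)
      (by simpa using (charVector_sup_add_inf FlagLattice.cells_sup FlagLattice.cells_inf a b).symm)
    simpa using this

theorem isIsoToToricVariety_strongerIdeal (hn : 2 ≤ n) [IsStrictOrder (GTPoset n) lt]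
    (hlt : ∀ p q : GTPoset n, p < q → lt p q) :
    IsIsoToToricVariety (multVariety (strongerIdeal lt))
      (markedOrderPolytope (extendOrder lt) (gtMarked n) (gtMarking n)) := by
  refine ⟨⟨n - 1, by omega, isNormalLatticePolytope_smul hn hlt⟩, fun k hk hnormal => ?_⟩
  obtain ⟨c, hc, hkc⟩ := exists_eq_mul_of_isLatticePolytope hn hk hnormal.1
  rw [hkc, latticePoints_smul hn hc, integralPatterns_eq hn hlt, multVariety_strongerIdeal_eq hn]
  -- As `c > 0`, every degree occurs in the multidegree `c • univ`.
  exact isomorphic_projToricVariety fun k => by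
    simp [Multiset.mem_nsmul, hc.ne']

/-- For the original order no coordinate is killed, which reduces the final claim to the general
one. -/
theorem idealSublattice_lt : idealSublattice (fun p q : GTPoset n => p < q) = Set.univ :=
  Set.eq_univ_of_forall fun a _ _ hpq hq => a.isLowerSet_cells hpq.le hq

theorem strongerIdeal_lt :
    strongerIdeal (fun p q : GTPoset n => p < q) = hibiIdeal (FlagLattice n) := by
  simp [strongerIdeal, hibiIdeal, idealSublattice_lt]

end Variety
end

theorem lemma4p5 (n : ℕ) (hn : 2 ≤ n) :
    (∀ lt' : GTPoset n → GTPoset n → Prop, IsStrictOrder (GTPoset n) lt' →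
      (∀ p q : GTPoset n, p < q → lt' p q) →
      IsIsoToToricVariety (multVariety (strongerIdeal lt'))
        (markedOrderPolytope (extendOrder lt') (gtMarked n) (gtMarking n))) ∧
    IsIsoToToricVariety (multVariety (hibiIdeal (FlagLattice n)))
      (markedOrderPolytope (extendOrder (fun p q : GTPoset n => p < q))
        (gtMarked n) (gtMarking n)) := by
  refine ⟨fun lt' _ hlt => isIsoToToricVariety_strongerIdeal hn hlt, ?_⟩
  rw [← strongerIdeal_lt]
  have : IsStrictOrder (GTPoset n) (fun p q : GTPoset n => p < q) :=
    inferInstanceAs (IsStrictOrder (GTPoset n) (· < ·))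
  exact isIsoToToricVariety_strongerIdeal hn fun _ _ h => h
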